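/- Let $b>1$ and $c>0$. For $k\in\left(0,\frac{c}{b+1}\right)$ there is a unique non-constant $\phi=\phi_k\in C^\infty(\mathbb R)$ such that $$-(c-\phi)(\phi'''-\phi')+b\,\phi'(\phi''-\phi)=0 \ \text{ on } \mathbb R,\qquad \phi'(0)=0,\qquad \phi(x)\to k \ \text{ as } |x|\to\infty$$ (the profile of the smooth solitary wave $u(t,x)=\phi(x-ct)$ of the $b$-Camassa--Holm equation $u_t-u_{txx}+(b+1)uu_x=b\,u_xu_{xx}+u\,u_{xxx}$ on the background $k$). It satisfies $0<\phi_k<c$, and the integral $$Q(\phi_k):=\int_{\mathbb R}\left[b\,\frac{c-k}{c-\phi_k(x)}-\left(\frac{c-k}{c-\phi_k(x)}\right)^{b}-b+1\right]dx$$ converges absolutely. The map $k\mapsto Q(\phi_k)$ is strictly increasing in the limits $k\to0$ and $k\to\frac{c}{b+1}$: there are $\delta_1,\delta_2\in\left(0,\frac{c}{b+1}\right)$ such that it is strictly increasing on $(0,\delta_1)$ and on $\left(\delta_2,\frac{c}{b+1}\right)$. Moreover, let $\gamma:=\frac{c-k(b+1)}{c-k}$, which maps $\left(0,\frac{c}{b+1}\right)$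 decreasingly onto $(0,1)$ with inverse $k=\frac{c(1-\gamma)}{b+1-\gamma}$, and regard $Q$ as a function of $\gamma\in(0,1)$. Then $Q$ is differentiable with $\frac{dQ}{d\gamma}<0$ for all $\gamma$ sufficiently close to $0$ and for all $\gamma$ sufficiently close to $1$, and $Q\to-\infty$ as $\gamma\to1$ (that is, as $k\to0$). -/

import Mathlib

open Filter Topology Set MeasureTheory
open scoped ContDiff

noncomputable section

/-- `φ` is the profile of a smooth solitary wave `u(t,x) = φ(x - c t)` of the `b`-Camassa-Holm equation
`u_t - u_{txx} + (b+1) u u_x = b u_x u_{xx} + u u_{xxx}` on the constant background `k`,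
centred so that `φ'(0) = 0`. The last field excludes the constant solution `φ = k`. -/
structure IsSolitaryWave (b c k : ℝ) (φ : ℝ → ℝ) : Prop where
  smooth : ContDiff ℝ ∞ φ
  ode : ∀ x, -(c - φ x) * (iteratedDeriv 3 φ x - deriv φ x)
    + b * deriv φ x * (iteratedDeriv 2 φ x - φ x) = 0
  centred : deriv φ 0 = 0
  tendsto_atTop : Tendsto φ atTop (𝓝 k)
  tendsto_atBot : Tendsto φ atBot (𝓝 k)
  nonconstant : ∃ x, φ x ≠ k

/-- The solitary wave profile with speed `c` on the background `k`. It is meaningful where exactly one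
profile exists; the main theorem asserts this for all `k` in `(0, c / (b + 1))`. -/
def solitaryWave (b c k : ℝ) : ℝ → ℝ := Classical.epsilon (IsSolitaryWave b c k)

/-- The integrand of the functional `Q`. -/
def densityQ (b c k : ℝ) (φ : ℝ → ℝ) (x : ℝ) : ℝ :=
  b * ((c - k) / (c - φ x)) - ((c - k) / (c - φ x)) ^ b - b + 1

/-- The map `k ↦ Q(φ)`, where `φ` is the solitary wave profile on the background `k`. -/
def mapQ (b c k : ℝ) : ℝ := ∫ x, densityQ b c k (solitaryWave b c k) x

/-- The normalized parameter `γ` as a function of `k`. -/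
def gammaOf (b c k : ℝ) : ℝ := (c - k * (b + 1)) / (c - k)

/-- The background `k` as a function of the normalized parameter `γ`, i.e. the inverse of `gammaOf`. -/
def kOf (b c γ : ℝ) : ℝ := c * (1 - γ) / (b + 1 - γ)

theorem kOf_gammaOf {b c k : ℝ} (hb : 1 < b) (hc : 0 < c) (hk : k ∈ Ioo 0 (c / (b + 1))) :
    gammaOf b c k ∈ Ioo (0 : ℝ) 1 ∧ kOf b c (gammaOf b c k) = k := by
  obtain ⟨h0, h1⟩ := hk
  rw [lt_div_iff₀ (by linarith)] at h1
  have h2 : 0 < c - k := by nlinarith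
  have h3 : b + 1 - (c - k * (b + 1)) / (c - k) = b * c / (c - k) := by
    field_simp
    ring
  refine ⟨⟨div_pos (by linarith) h2, ?_⟩, ?_⟩
  · rw [gammaOf, div_lt_one h2]
    nlinarith
  · rw [kOf, gammaOf, h3]
    have : b ≠ 0 := by linarith
    field_simp
    ring

theorem gammaOf_kOf {b c γ : ℝ} (hb : 1 < b) (hc : 0 < c) (hγ : γ ∈ Ioo (0 : ℝ) 1) :
    kOf b c γ ∈ Ioo 0 (c / (b + 1)) ∧ gammaOf b c (kOf b c γ) = γ := by
  obtain ⟨h0, h1⟩ := hγ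
  have h2 : 0 < b + 1 - γ := by linarith
  have h3 : c - c * (1 - γ) / (b + 1 - γ) = b * c / (b + 1 - γ) := by
    field_simp
    ring
  refine ⟨⟨div_pos (mul_pos hc (by linarith)) h2, ?_⟩, ?_⟩
  · rw [kOf, div_lt_div_iff₀ h2 (by linarith)]
    nlinarith [mul_pos (mul_pos hc h0) (by linarith : 0 < b)]
  · rw [gammaOf, kOf, h3]
    have : b ≠ 0 := by linarith
    field_simp
    ring

end

/-! Where φ < c the equation says that (φ - φ'')(c - φ)^b is constant, and the limit at infinity
fixes the constant as k(c-k)^b. With φ = k + (c-k)z and κ = k/(c-k) this is the Newton equation z''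
= z - κh'(z), where h = `pot`. The decay of z gives zero energy, z'² = z²(1 - κH(z)) with H = 2h/z²
= `potRatio`. On (0,1) the function H increases from b to infinity, so there is exactly one turning
point, at H = 1/κ = b + Y with Y = `amplitude`. ODE uniqueness then gives the wave up to
translation. The bound φ < c holds because the conserved quantity would vanish at a contact with c.

The homoclinic orbit is uniformized by H(z) = b + Y(1 - σ²), σ ∈ (-1,1). The square root in the
energy law disappears: z' = -√(Y/(b+Y)) σz and dx = 2√(Y(b+Y))/(zH'(z)) dσ. With W = dens/(zH') =
`weight`, this turns the functional into -Q = 2√(Y(b+Y)) ∫ W(z(σ)) dσ over a fixed interval, with an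
integrand that stays bounded (`integral_dens_profile`).

Put I = ∫ W and J = ∫ (H - b)W'/H'. Since 1 - σ² = (H - b)/Y, the derivative of -Q in Y has the sign
of 2(b+Y)(I/2 + J) + YI, and I > 0. For small Y the orbit stays near z = 0, where W' > 0, so J ≥ 0.
For large Y it concentrates at the peak z = 1, where W → 1/2 and (H - b)W'/H' → 0, so I → 1 and J →
0. In both regimes -Q increases in Y, and -Q → ∞ as Y → ∞. Finally Y = bγ/(1-γ) increases with γ,
while γ decreases with k. -/

/-! ### Calculus helpers -/

theorem le_of_hasDerivAt_nonneg {f f' : ℝ → ℝ} {a b : ℝ} (hab : a ≤ b)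
    (hf : ∀ x ∈ Icc a b, HasDerivAt f (f' x) x) (h : ∀ x ∈ Icc a b, 0 ≤ f' x) : f a ≤ f b := by
  refine monotoneOn_of_deriv_nonneg (convex_Icc a b) (HasDerivAt.continuousOn hf) ?_ ?_
    (left_mem_Icc.2 hab) (right_mem_Icc.2 hab) hab
  · intro x hx
    exact (hf x (interior_subset hx)).differentiableAt.differentiableWithinAt
  · intro x hx
    rw [(hf x (interior_subset hx)).deriv]
    exact h x (interior_subset hx)

/-- At the base point the power series is shifted by one; elsewhere this is a quotient of analytic
functions. Applied twice, it removes the singularity of f(z)/z². -/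
theorem AnalyticAt.dslope_real {f : ℝ → ℝ} {a z : ℝ} (ha : AnalyticAt ℝ f a)
    (hz : AnalyticAt ℝ f z) : AnalyticAt ℝ (dslope f a) z := by
  rcases eq_or_ne z a with rfl | h
  · obtain ⟨p, hp⟩ := ha
    exact ⟨_, hp.has_fpower_series_dslope_fslope⟩
  · have h1 : AnalyticAt ℝ (fun x => (f x - f a) / (x - a)) z :=
      (hz.sub analyticAt_const).fun_div (analyticAt_id.sub analyticAt_const) (sub_ne_zero.2 h)
    refine h1.congr ?_
    filter_upwards [isOpen_ne.mem_nhds h] with x hx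
    rw [dslope_of_ne f hx, slope_def_field]

theorem dslope_dslope_zero_of_ne {f : ℝ → ℝ} (h0 : f 0 = 0) (h1 : HasDerivAt f 0 0) {z : ℝ}
    (hz : z ≠ 0) : dslope (dslope f 0) 0 z = f z / z ^ 2 := by
  rw [dslope_of_ne _ hz, slope_def_field, dslope_same, h1.deriv, dslope_of_ne _ hz,
    slope_def_field, h0]
  field_simp
  ring

theorem hasDerivAt_one_sub_rpow (r : ℝ) {z : ℝ} (hz : z < 1) :
    HasDerivAt (fun z : ℝ => (1 - z) ^ r) (-(r * (1 - z) ^ (r - 1))) z := by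
  have h := ((hasDerivAt_id z).const_sub 1).rpow_const (p := r) (Or.inl (sub_pos.2 hz).ne')
  convert! h using 1
  simp

theorem analyticAt_one_sub_rpow (r : ℝ) {z : ℝ} (hz : z < 1) :
    AnalyticAt ℝ (fun z : ℝ => (1 - z) ^ r) z := by
  apply ContDiffAt.analyticAt
  exact (contDiffAt_const.sub contDiffAt_id).rpow_const_of_ne (sub_pos.2 hz).ne'

theorem one_le_one_sub_rpow_neg {r z : ℝ} (hr : 0 ≤ r) (h0 : 0 ≤ z) (h1 : z < 1) :
    1 ≤ (1 - z) ^ (-r) :=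
  Real.one_le_rpow_of_pos_of_le_one_of_nonpos (by linarith) (by linarith) (by linarith)

/-! ### The potential of the normalized profile equation -/

noncomputable section

/-- The potential `h` in the normalized profile equation `z'' = z - κ h'(z)`. -/
def pot (b z : ℝ) : ℝ := ((1 - z) ^ (1 - b) - 1) / (b - 1) - z

/-- The derivative of `pot`. -/
def dpot (b z : ℝ) : ℝ := (1 - z) ^ (-b) - 1

/-- The numerator `z h'(z) - 2 h(z)` of the logarithmic derivative of `h(z) / z ^ 2`. -/
def potNum (b z : ℝ) : ℝ := z * dpot b z - 2 * pot b z

/-- The function `2 h(z) / z ^ 2`, continued analytically to `z = 0`. -/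
def potRatio (b z : ℝ) : ℝ := 2 * dslope (dslope (pot b) 0) 0 z

/-- The negative of the density of `Q`, as a function of the normalized profile. -/
def dens (b z : ℝ) : ℝ := (1 - z) ^ (-b) - b * (1 - z) ^ (-1 : ℝ) + b - 1

/-- The function `dens b z / z ^ 2`, continued analytically to `z = 0`. -/
def densRatio (b z : ℝ) : ℝ := dslope (dslope (dens b) 0) 0 z

/-- The function `dens b z / (z * H' z)` with `H = potRatio b`, continued analytically to `z = 0`. -/
def weight (b z : ℝ) : ℝ := z * densRatio b z / deriv (potRatio b) z

end

theorem hasDerivAt_pot {b z : ℝ} (hb : 1 < b) (hz : z < 1) : HasDerivAt (pot b) (dpot b z) z := by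
  have h := (((hasDerivAt_one_sub_rpow (1 - b) hz).sub_const 1).div_const (b - 1)).sub
    (hasDerivAt_id z)
  convert! h using 1
  have : b - 1 ≠ 0 := by linarith
  rw [dpot, show 1 - b - 1 = -b by ring]
  field_simp
  ring

theorem hasDerivAt_dpot (b : ℝ) {z : ℝ} (hz : z < 1) :
    HasDerivAt (dpot b) (b * (1 - z) ^ (-b - 1)) z := by
  convert! (hasDerivAt_one_sub_rpow (-b) hz).sub_const 1 using 1
  ring

theorem hasDerivAt_potNum {b z : ℝ} (hb : 1 < b) (hz : z < 1) :
    HasDerivAt (potNum b) (z * (b * (1 - z) ^ (-b - 1)) - dpot b z) z := by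
  convert! ((hasDerivAt_id z).mul (hasDerivAt_dpot b hz)).sub ((hasDerivAt_pot hb hz).const_mul 2)
    using 1
  simp
  ring

theorem pot_zero (b : ℝ) : pot b 0 = 0 := by simp [pot]

theorem dpot_zero (b : ℝ) : dpot b 0 = 0 := by simp [dpot]

theorem potNum_zero (b : ℝ) : potNum b 0 = 0 := by simp [potNum, pot_zero]

theorem analyticAt_pot (b : ℝ) {z : ℝ} (hz : z < 1) : AnalyticAt ℝ (pot b) z := by
  unfold pot
  simp only [div_eq_mul_inv]
  exact (((analyticAt_one_sub_rpow (1 - b) hz).sub analyticAt_const).mul analyticAt_const).sub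
    analyticAt_id

/-- Two integrations from 0: the derivative of `potNum` is zh'' - h', whose own derivative is zh'''
= b(b+1)z(1-z)^(-b-2) ≥ b(b+1)z. The cubic rate is what makes H' positive even at z = 0. -/
theorem potNum_lower {b z : ℝ} (hb : 1 < b) (h0 : 0 ≤ z) (hz : z < 1) :
    b * (b + 1) / 6 * z ^ 3 ≤ potNum b z := by
  have h1 : ∀ z, 0 ≤ z → z < 1 →
      b * (b + 1) / 2 * z ^ 2 ≤ z * (b * (1 - z) ^ (-b - 1)) - dpot b z := by
    intro z h0 hz
    have hd : ∀ x ∈ Icc 0 z, HasDerivAt (fun x => x * (b * (1 - x) ^ (-b - 1)) - dpot b x -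
        b * (b + 1) / 2 * x ^ 2) (b * (b + 1) * x * ((1 - x) ^ (-b - 2) - 1)) x := by
      intro x hx
      have hx1 : x < 1 := hx.2.trans_lt hz
      convert! (((hasDerivAt_id x).mul ((hasDerivAt_one_sub_rpow (-b - 1) hx1).const_mul b)).sub
        (hasDerivAt_dpot b hx1)).sub ((hasDerivAt_pow 2 x).const_mul (b * (b + 1) / 2)) using 1
      rw [show -b - 1 - 1 = -b - 2 by ring]
      simp
      ring
    have := le_of_hasDerivAt_nonneg h0 hd (by
      intro x hx
      have := one_le_one_sub_rpow_neg (r := b + 2) (by linarith) hx.1 (hx.2.trans_lt hz)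
      rw [show -(b + 2) = -b - 2 by ring] at this
      have := hx.1
      apply mul_nonneg <;> [positivity; linarith])
    simp [dpot_zero] at this
    linarith
  have hd : ∀ x ∈ Icc 0 z, HasDerivAt (fun x => potNum b x - b * (b + 1) / 6 * x ^ 3)
      (x * (b * (1 - x) ^ (-b - 1)) - dpot b x - b * (b + 1) / 2 * x ^ 2) x := by
    intro x hx
    have hx1 : x < 1 := hx.2.trans_lt hz
    convert! (hasDerivAt_potNum hb hx1).sub ((hasDerivAt_pow 3 x).const_mul (b * (b + 1) / 6))
      using 1
    simp
    ring
  have := le_of_hasDerivAt_nonneg h0 hd (by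
    intro x hx
    linarith [h1 x hx.1 (hx.2.trans_lt hz)])
  simp [potNum_zero] at this
  linarith

theorem analyticAt_potRatio {b z : ℝ} (hz : z < 1) : AnalyticAt ℝ (potRatio b) z :=
  analyticAt_const.mul (((analyticAt_pot b one_pos).dslope_real (analyticAt_pot b one_pos)).dslope_real
    ((analyticAt_pot b one_pos).dslope_real (analyticAt_pot b hz)))

theorem potRatio_of_ne {b z : ℝ} (hb : 1 < b) (hz : z ≠ 0) : potRatio b z = 2 * pot b z / z ^ 2 := by
  have h1 : HasDerivAt (pot b) 0 0 := by simpa [dpot_zero] using hasDerivAt_pot hb one_pos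
  rw [potRatio, dslope_dslope_zero_of_ne (pot_zero b) h1 hz]
  ring

theorem sq_mul_potRatio {b : ℝ} (hb : 1 < b) (z : ℝ) : z ^ 2 * potRatio b z = 2 * pot b z := by
  rcases eq_or_ne z 0 with rfl | hz
  · simp [pot_zero]
  · rw [potRatio_of_ne hb hz]
    field_simp

theorem hasDerivAt_potRatio {b z : ℝ} (hz : z < 1) :
    HasDerivAt (potRatio b) (deriv (potRatio b) z) z :=
  (analyticAt_potRatio hz).differentiableAt.hasDerivAt

theorem dpot_eq {b z : ℝ} (hb : 1 < b) (hz : z < 1) :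
    dpot b z = z * potRatio b z + z ^ 2 * deriv (potRatio b) z / 2 := by
  have h1 := ((hasDerivAt_pow 2 z).mul (hasDerivAt_potRatio (b := b) hz)).div_const 2
  have h2 : pot b = fun z => z ^ 2 * potRatio b z / 2 := by
    ext z
    rw [sq_mul_potRatio hb]
    ring
  have h3 := hasDerivAt_pot hb hz
  rw [h2] at h3
  rw [h3.unique h1]
  simp
  ring

theorem cube_mul_deriv_potRatio {b z : ℝ} (hb : 1 < b) (hz : z < 1) :
    z ^ 3 * deriv (potRatio b) z = 2 * potNum b z := by
  rw [potNum, dpot_eq hb hz, ← sq_mul_potRatio hb]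
  ring

/-- Both sides are limits at 0 of h'(z)/z = H + zH'/2, and the limit of the quotient is h''(0) = b.
-/
theorem potRatio_zero {b : ℝ} (hb : 1 < b) : potRatio b 0 = b := by
  have h1 : Tendsto (fun z => potRatio b z + z * deriv (potRatio b) z / 2) (𝓝[≠] 0)
      (𝓝 (potRatio b 0 + 0 * deriv (potRatio b) 0 / 2)) := by
    have h2 := (analyticAt_potRatio (b := b) one_pos).continuousAt
    have h3 := (analyticAt_potRatio (b := b) one_pos).deriv.continuousAt
    exact ((h2.add ((continuousAt_id.mul h3).div_const 2)).tendsto).mono_left nhdsWithin_le_nhds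
  have h2 : Tendsto (fun z => dpot b z / z) (𝓝[≠] 0) (𝓝 b) := by
    have := (hasDerivAt_dpot b one_pos).tendsto_slope
    simp only [sub_zero, Real.one_rpow, mul_one] at this
    refine this.congr fun z => ?_
    rw [slope_def_field, dpot_zero, sub_zero, sub_zero]
  have h3 : (fun z => potRatio b z + z * deriv (potRatio b) z / 2) =ᶠ[𝓝[≠] 0]
      fun z => dpot b z / z := by
    filter_upwards [self_mem_nhdsWithin, mem_nhdsWithin_of_mem_nhds (Iio_mem_nhds one_pos)]
      with z hz hz1
    have hz : z ≠ 0 := hz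
    rw [dpot_eq hb hz1]
    field_simp
  have := tendsto_nhds_unique (h1.congr' h3) h2
  simpa using this

theorem deriv_potRatio_lower {b z : ℝ} (hb : 1 < b) (h0 : 0 ≤ z) (hz : z < 1) :
    b * (b + 1) / 3 ≤ deriv (potRatio b) z := by
  have hpos : ∀ z, 0 < z → z < 1 → b * (b + 1) / 3 ≤ deriv (potRatio b) z := by
    intro z h0 hz
    have h1 := cube_mul_deriv_potRatio hb hz
    have h2 := potNum_lower hb h0.le hz
    have : 0 < z ^ 3 := by positivity
    refine le_of_mul_le_mul_left ?_ this
    linarith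
  rcases h0.eq_or_lt with rfl | h0
  · have h2 := (analyticAt_potRatio (b := b) one_pos).deriv.continuousAt
    refine ge_of_tendsto (h2.tendsto.mono_left (nhdsWithin_le_nhds (s := Ioi 0))) ?_
    filter_upwards [Ioo_mem_nhdsGT (show (0 : ℝ) < 1 by norm_num)] with x hx
    exact hpos x hx.1 hx.2
  · exact hpos z h0 hz

theorem deriv_potRatio_pos {b z : ℝ} (hb : 1 < b) (h0 : 0 ≤ z) (hz : z < 1) :
    0 < deriv (potRatio b) z :=
  lt_of_lt_of_le (by positivity) (deriv_potRatio_lower hb h0 hz)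

theorem add_le_potRatio {b z : ℝ} (hb : 1 < b) (h0 : 0 ≤ z) (hz : z < 1) :
    b + b * (b + 1) / 3 * z ≤ potRatio b z := by
  have hd : ∀ x ∈ Icc 0 z, HasDerivAt (fun x => potRatio b x - b * (b + 1) / 3 * x)
      (deriv (potRatio b) x - b * (b + 1) / 3) x := by
    intro x hx
    convert! (hasDerivAt_potRatio (hx.2.trans_lt hz)).sub
      ((hasDerivAt_id x).const_mul (b * (b + 1) / 3)) using 1
    simp
  have := le_of_hasDerivAt_nonneg h0 hd (by
    intro x hx
    linarith [deriv_potRatio_lower hb hx.1 (hx.2.trans_lt hz)])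
  simp [potRatio_zero hb] at this
  linarith

theorem tendsto_one_sub_nhdsLT : Tendsto (fun z : ℝ => 1 - z) (𝓝[<] 1) (𝓝[>] 0) := by
  refine tendsto_nhdsWithin_iff.2 ⟨?_, ?_⟩
  · have : Tendsto (fun z : ℝ => 1 - z) (𝓝 1) (𝓝 (1 - 1)) := (continuous_const.sub continuous_id).tendsto 1
    rw [sub_self] at this
    exact this.mono_left nhdsWithin_le_nhds
  · filter_upwards [self_mem_nhdsWithin] with z hz
    exact sub_pos.2 (mem_Iio.1 hz)

/-- On (0,1) one has H ≥ z²H = 2h, and h blows up at 1 because 1 - b < 0. -/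
theorem tendsto_potRatio_nhdsLT {b : ℝ} (hb : 1 < b) : Tendsto (potRatio b) (𝓝[<] 1) atTop := by
  have h1 : Tendsto (fun z : ℝ => (1 - z) ^ (1 - b)) (𝓝[<] 1) atTop :=
    (tendsto_rpow_neg_nhdsGT_zero (by linarith)).comp tendsto_one_sub_nhdsLT
  have h2 : Tendsto (fun z : ℝ => 2 * (((1 - z) ^ (1 - b) - 1) / (b - 1) - 1)) (𝓝[<] 1) atTop := by
    refine Tendsto.const_mul_atTop two_pos ?_
    refine tendsto_atTop_add_const_right _ _ ?_
    exact (tendsto_atTop_add_const_right _ _ h1).atTop_div_const (by linarith)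
  refine tendsto_atTop_mono' _ ?_ (h2)
  filter_upwards [Ioo_mem_nhdsLT (show (0 : ℝ) < 1 by norm_num), h2.eventually_ge_atTop 0]
    with z hz h3
  have h4 := sq_mul_potRatio hb z
  have h5 : z ^ 2 ≤ 1 := by nlinarith [hz.1, hz.2]
  have h6 : 0 ≤ potRatio b z := le_trans (by have := hz.1; positivity) (add_le_potRatio hb hz.1.le hz.2)
  have h7 : z ^ 2 * potRatio b z ≤ potRatio b z := by nlinarith
  rw [pot] at h4
  linarith [hz.2]

/-! ### The density -/

theorem hasDerivAt_dens (b : ℝ) {z : ℝ} (hz : z < 1) :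
    HasDerivAt (dens b) (b * (1 - z) ^ (-b - 1) - b * (1 - z) ^ (-2 : ℝ)) z := by
  convert! (((hasDerivAt_one_sub_rpow (-b) hz).sub
    ((hasDerivAt_one_sub_rpow (-1) hz).const_mul b)).add_const b).sub_const 1 using 1
  rw [show (-1 : ℝ) - 1 = -2 by norm_num]
  ring

theorem dens_zero (b : ℝ) : dens b 0 = 0 := by simp [dens]

theorem analyticAt_dens (b : ℝ) {z : ℝ} (hz : z < 1) : AnalyticAt ℝ (dens b) z :=
  (((analyticAt_one_sub_rpow (-b) hz).sub
    (analyticAt_const.mul (analyticAt_one_sub_rpow (-1) hz))).add analyticAt_const).sub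
    analyticAt_const

/-- Two integrations from 0: since b + 2 ≥ 3, the second derivative is at least (b(b+1) -
2b)(1-z)^(-3) ≥ b(b-1). -/
theorem dens_lower {b z : ℝ} (hb : 1 < b) (h0 : 0 ≤ z) (hz : z < 1) :
    b * (b - 1) / 2 * z ^ 2 ≤ dens b z := by
  have h1 : ∀ z, 0 ≤ z → z < 1 →
      b * (b - 1) * z ≤ b * (1 - z) ^ (-b - 1) - b * (1 - z) ^ (-2 : ℝ) := by
    intro z h0 hz
    have hd : ∀ x ∈ Icc 0 z, HasDerivAt (fun x => b * (1 - x) ^ (-b - 1) - b * (1 - x) ^ (-2 : ℝ) -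
        b * (b - 1) * x) (b * (b + 1) * (1 - x) ^ (-b - 2) - 2 * b * (1 - x) ^ (-3 : ℝ)
          - b * (b - 1)) x := by
      intro x hx
      have hx1 : x < 1 := hx.2.trans_lt hz
      convert! (((hasDerivAt_one_sub_rpow (-b - 1) hx1).const_mul b).sub
        ((hasDerivAt_one_sub_rpow (-2) hx1).const_mul b)).sub
        ((hasDerivAt_id x).const_mul (b * (b - 1))) using 1
      rw [show -b - 1 - 1 = -b - 2 by ring, show (-2 : ℝ) - 1 = -3 by norm_num]
      ring
    have := le_of_hasDerivAt_nonneg h0 hd (by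
      intro x hx
      have hx1 : x < 1 := hx.2.trans_lt hz
      have h2 := one_le_one_sub_rpow_neg (r := 3) (by linarith) hx.1 hx1
      have h3 : (1 - x) ^ (-3 : ℝ) ≤ (1 - x) ^ (-b - 2) :=
        Real.rpow_le_rpow_of_exponent_ge (by linarith) (by linarith [hx.1]) (by linarith)
      have h4 : b * (b + 1) * (1 - x) ^ (-3 : ℝ) ≤ b * (b + 1) * (1 - x) ^ (-b - 2) := by gcongr
      have h5 : b * (b - 1) * 1 ≤ b * (b - 1) * (1 - x) ^ (-3 : ℝ) :=
        mul_le_mul_of_nonneg_left h2 (mul_nonneg (by linarith) (by linarith))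
      linarith)
    simp only [sub_zero, Real.one_rpow, mul_one, sub_self, mul_zero] at this
    linarith
  have hd : ∀ x ∈ Icc 0 z, HasDerivAt (fun x => dens b x - b * (b - 1) / 2 * x ^ 2)
      (b * (1 - x) ^ (-b - 1) - b * (1 - x) ^ (-2 : ℝ) - b * (b - 1) * x) x := by
    intro x hx
    have hx1 : x < 1 := hx.2.trans_lt hz
    convert! (hasDerivAt_dens b hx1).sub ((hasDerivAt_pow 2 x).const_mul (b * (b - 1) / 2)) using 1
    simp
    ring
  have := le_of_hasDerivAt_nonneg h0 hd (by
    intro x hx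
    linarith [h1 x hx.1 (hx.2.trans_lt hz)])
  simp [dens_zero] at this
  linarith

theorem analyticAt_densRatio {b z : ℝ} (hz : z < 1) : AnalyticAt ℝ (densRatio b) z :=
  ((analyticAt_dens b one_pos).dslope_real (analyticAt_dens b one_pos)).dslope_real
    ((analyticAt_dens b one_pos).dslope_real (analyticAt_dens b hz))

theorem densRatio_of_ne {b z : ℝ} (hz : z ≠ 0) : densRatio b z = dens b z / z ^ 2 := by
  have h1 : HasDerivAt (dens b) 0 0 := by
    have := hasDerivAt_dens b one_pos
    simpa using this
  rw [densRatio, dslope_dslope_zero_of_ne (dens_zero b) h1 hz]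

theorem densRatio_pos {b z : ℝ} (hb : 1 < b) (h0 : 0 ≤ z) (hz : z < 1) : 0 < densRatio b z := by
  have hb1 : 0 < b * (b - 1) / 2 := by
    have := mul_pos (zero_lt_one.trans hb) (sub_pos.2 hb)
    linarith
  have hpos : ∀ z, 0 < z → z < 1 → b * (b - 1) / 2 ≤ densRatio b z := by
    intro z h0 hz
    rw [densRatio_of_ne h0.ne', le_div_iff₀ (by positivity)]
    exact dens_lower hb h0.le hz
  rcases h0.eq_or_lt with rfl | h0
  · have h2 := (analyticAt_densRatio (b := b) one_pos).continuousAt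
    refine hb1.trans_le (ge_of_tendsto (h2.tendsto.mono_left (nhdsWithin_le_nhds (s := Ioi 0))) ?_)
    filter_upwards [Ioo_mem_nhdsGT (show (0 : ℝ) < 1 by norm_num)] with x hx
    exact hpos x hx.1 hx.2
  · exact hb1.trans_le (hpos z h0 hz)

theorem analyticAt_weight {b z : ℝ} (hb : 1 < b) (h0 : 0 ≤ z) (hz : z < 1) :
    AnalyticAt ℝ (weight b) z :=
  (analyticAt_id.mul (analyticAt_densRatio hz)).fun_div (analyticAt_potRatio hz).deriv
    (deriv_potRatio_pos hb h0 hz).ne'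

theorem weight_pos {b z : ℝ} (hb : 1 < b) (h0 : 0 < z) (hz : z < 1) : 0 < weight b z :=
  div_pos (mul_pos h0 (densRatio_pos hb h0.le hz)) (deriv_potRatio_pos hb h0.le hz)

theorem dens_eq_weight {b z : ℝ} (hb : 1 < b) (h0 : 0 < z) (hz : z < 1) :
    dens b z = weight b z * (z * deriv (potRatio b) z) := by
  have := (deriv_potRatio_pos hb h0.le hz).ne'
  rw [weight, densRatio_of_ne h0.ne']
  field_simp

theorem weight_eq {b z : ℝ} (hb : 1 < b) (h0 : 0 < z) (hz : z < 1) :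
    weight b z = z ^ 2 * dens b z / (2 * potNum b z) := by
  have := (deriv_potRatio_pos hb h0.le hz).ne'
  rw [weight, densRatio_of_ne h0.ne', ← cube_mul_deriv_potRatio hb hz]
  field_simp

/-- W has a simple zero at 0 with slope `densRatio b 0 / deriv (potRatio b) 0`, a ratio of positive
numbers; W' is continuous there. -/
theorem eventually_deriv_weight_pos {b : ℝ} (hb : 1 < b) : ∀ᶠ z in 𝓝 (0 : ℝ), 0 < deriv (weight b) z := by
  have h1 := (analyticAt_weight hb le_rfl one_pos).deriv.continuousAt
  refine h1.eventually (lt_mem_nhds ?_)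
  have h2 : HasDerivAt (weight b) (densRatio b 0 / deriv (potRatio b) 0) 0 := by
    have hd := (deriv_potRatio_pos hb le_rfl one_pos).ne'
    convert! ((hasDerivAt_id (0 : ℝ)).mul
      (analyticAt_densRatio (b := b) one_pos).differentiableAt.hasDerivAt).div
      (analyticAt_potRatio (b := b) one_pos).deriv.differentiableAt.hasDerivAt hd using 1
    simp
    field_simp
  rw [h2.deriv]
  exact div_pos (densRatio_pos hb le_rfl one_pos) (deriv_potRatio_pos hb le_rfl one_pos)

/-! ### Behaviour of the weight at the peak `z = 1` -/

noncomputable section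

/-- The function `(1 - z) ^ b * dens b z`, where `r = (1 - z) ^ (b - 1)`. -/
def densScaled (b z r : ℝ) : ℝ := 1 - b * r + (b - 1) * ((1 - z) * r)

/-- The function `(1 - z) ^ b * potNum b z`, where `r = (1 - z) ^ (b - 1)`. -/
def potNumScaled (b z r : ℝ) : ℝ :=
  z * (1 - (1 - z) * r) - 2 * (((1 - z) - (1 - z) * r) / (b - 1) - z * ((1 - z) * r))

/-- The function `(1 - z) ^ (b - 1) * (2 * pot b z - b * z ^ 2)`, where `r = (1 - z) ^ (b - 1)`. -/
def potRemScaled (b z r : ℝ) : ℝ := 2 * ((1 - r) / (b - 1) - z * r) - b * z ^ 2 * r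

/-- The function `(1 - z) * deriv (weight b) z`, where `r = (1 - z) ^ (b - 1)`. -/
def dweightScaled (b z r : ℝ) : ℝ :=
  ((2 * z * (1 - z) * densScaled b z r +
      z ^ 2 * (b * ((b - 1) * r) + (b - 1) * (-((1 - z) * r) - (1 - z) * ((b - 1) * r)))) *
        (2 * potNumScaled b z r) -
    z ^ 2 * densScaled b z r * (2 * ((1 - z) * (1 - (1 - z) * r) + z * ((1 - z) * (b * r)) -
      2 * ((-(1 - z) + (1 - z) * (b * r)) / (b - 1) -
        ((1 - z) * ((1 - z) * r) - z * ((1 - z) * (b * r))))))) /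
    (2 * potNumScaled b z r) ^ 2

end

/-- All singular powers at the peak are expressed through 1 - z and r = (1-z)^(b-1). Treating r as
an independent variable turns limits at z = 1 into evaluations of rational functions at (z, r) = (1,
0), although r need not be differentiable in z at 1. -/
theorem one_sub_rpow_neg_eq {b z : ℝ} (hz : z < 1) :
    (1 - z) ^ (-b) = ((1 - z) * (1 - z) ^ (b - 1))⁻¹ := by
  rw [Real.rpow_neg (by linarith), Real.rpow_sub_one (by linarith)]
  have : 1 - z ≠ 0 := by linarith
  field_simp

theorem dens_eq_scaled {b z : ℝ} (hz : z < 1) :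
    dens b z = densScaled b z ((1 - z) ^ (b - 1)) / ((1 - z) * (1 - z) ^ (b - 1)) := by
  have h1 : 1 - z ≠ 0 := by linarith
  have h2 : (1 - z) ^ (b - 1) ≠ 0 := (Real.rpow_pos_of_pos (by linarith) _).ne'
  rw [dens, one_sub_rpow_neg_eq hz, Real.rpow_neg_one, densScaled]
  field_simp
  ring

theorem pot_eq_scaled {b z : ℝ} (hz : z < 1) :
    pot b z = (((1 - z) ^ (b - 1))⁻¹ - 1) / (b - 1) - z := by
  rw [pot, show 1 - b = -(b - 1) by ring, Real.rpow_neg (by linarith)]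

theorem potNum_eq_scaled {b z : ℝ} (hb : 1 < b) (hz : z < 1) :
    potNum b z = potNumScaled b z ((1 - z) ^ (b - 1)) / ((1 - z) * (1 - z) ^ (b - 1)) := by
  have h1 : 1 - z ≠ 0 := by linarith
  have h2 : (1 - z) ^ (b - 1) ≠ 0 := (Real.rpow_pos_of_pos (by linarith) _).ne'
  have h3 : b - 1 ≠ 0 := by linarith
  rw [potNum, dpot, one_sub_rpow_neg_eq hz, pot_eq_scaled hz, potNumScaled]
  field_simp

theorem potRem_eq_scaled {b z : ℝ} (hb : 1 < b) (hz : z < 1) :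
    2 * pot b z - b * z ^ 2 = potRemScaled b z ((1 - z) ^ (b - 1)) / (1 - z) ^ (b - 1) := by
  have h2 : (1 - z) ^ (b - 1) ≠ 0 := (Real.rpow_pos_of_pos (by linarith) _).ne'
  have h3 : b - 1 ≠ 0 := by linarith
  rw [pot_eq_scaled hz, potRemScaled]
  field_simp

theorem weight_eq_scaled {b z : ℝ} (hb : 1 < b) (h0 : 0 < z) (hz : z < 1) :
    weight b z = z ^ 2 * densScaled b z ((1 - z) ^ (b - 1)) /
      (2 * potNumScaled b z ((1 - z) ^ (b - 1))) := by
  have h1 : 1 - z ≠ 0 := by linarith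
  have h2 : (1 - z) ^ (b - 1) ≠ 0 := (Real.rpow_pos_of_pos (by linarith) _).ne'
  rw [weight_eq hb h0 hz, dens_eq_scaled hz, potNum_eq_scaled hb hz]
  field_simp

theorem potNumScaled_pos {b z : ℝ} (hb : 1 < b) (h0 : 0 < z) (hz : z < 1) :
    0 < potNumScaled b z ((1 - z) ^ (b - 1)) := by
  have h1 : 0 < 1 - z := by linarith
  have h2 : 0 < (1 - z) ^ (b - 1) := Real.rpow_pos_of_pos h1 _
  have h3 : 0 < potNum b z := lt_of_lt_of_le (by positivity) (potNum_lower hb h0.le hz)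
  rw [potNum_eq_scaled hb hz] at h3
  exact (div_pos_iff_of_pos_right (by positivity)).1 h3

/-- The relation (1-z)r' = -(b-1)r shows that the factor 1 - z is exactly what keeps the derivative
rational in z and r. -/
theorem one_sub_mul_deriv_weight {b z : ℝ} (hb : 1 < b) (h0 : 0 < z) (hz : z < 1) :
    (1 - z) * deriv (weight b) z = dweightScaled b z ((1 - z) ^ (b - 1)) := by
  have hr' := hasDerivAt_one_sub_rpow (b - 1) hz
  have hrel : (1 - z) * (-((b - 1) * (1 - z) ^ (b - 1 - 1))) = -((b - 1) * (1 - z) ^ (b - 1)) := by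
    rw [Real.rpow_sub_one (by linarith) (b - 1)]
    have h1 : 1 - z ≠ 0 := by linarith
    field_simp
  set r' := -((b - 1) * (1 - z) ^ (b - 1 - 1))
  have he : HasDerivAt (fun z : ℝ => 1 - z) (-1) z := (hasDerivAt_id z).const_sub 1
  have her := he.mul hr'
  have hD := (((hr'.const_mul b).const_sub 1).add (her.const_mul (b - 1)))
  have hN := ((hasDerivAt_id z).mul (her.const_sub 1)).sub
    ((((he.sub her).div_const (b - 1)).sub ((hasDerivAt_id z).mul her)).const_mul 2)
  have hne : potNumScaled b z ((1 - z) ^ (b - 1)) ≠ 0 := (potNumScaled_pos hb h0 hz).ne'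
  have hW := ((hasDerivAt_pow 2 z).mul hD).div (hN.const_mul 2) (mul_ne_zero two_ne_zero hne)
  have hev : weight b =ᶠ[𝓝 z] fun z => z ^ 2 * densScaled b z ((1 - z) ^ (b - 1)) /
      (2 * potNumScaled b z ((1 - z) ^ (b - 1))) := by
    filter_upwards [Ioo_mem_nhds h0 hz] with x hx
    exact weight_eq_scaled hb hx.1 hx.2
  have hd : deriv (weight b) z = _ := (HasDerivAt.congr_of_eventuallyEq hW hev).deriv
  rw [hd, dweightScaled, mul_div_assoc']
  congr 1
  have h3 : b - 1 ≠ 0 := by linarith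
  simp only [densScaled, potNumScaled, id, Pi.mul_apply, Pi.sub_apply, Pi.add_apply]
  have h1 : 1 - z ≠ 0 := by linarith
  have hr2 : r' = -((b - 1) * (1 - z) ^ (b - 1)) / (1 - z) := by
    rw [← hrel]
    field_simp
  rw [hr2]
  generalize (1 - z) ^ (b - 1) = r
  field_simp
  ring

theorem tendsto_one_sub_rpow_nhdsLT {b : ℝ} (hb : 1 < b) :
    Tendsto (fun z : ℝ => (z, (1 - z) ^ (b - 1))) (𝓝[<] 1) (𝓝 ((1 : ℝ), (0 : ℝ))) := by
  refine (tendsto_id.mono_left nhdsWithin_le_nhds).prodMk_nhds ?_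
  have h : ContinuousAt (fun x : ℝ => x ^ (b - 1)) 0 :=
    Real.continuousAt_rpow_const _ _ (Or.inr (by linarith))
  have h2 := h.tendsto.comp (tendsto_nhds_of_tendsto_nhdsWithin tendsto_one_sub_nhdsLT)
  simpa [Real.zero_rpow (show b - 1 ≠ 0 by linarith), Function.comp_def] using h2

theorem tendsto_weight_nhdsLT {b : ℝ} (hb : 1 < b) : Tendsto (weight b) (𝓝[<] 1) (𝓝 (1 / 2)) := by
  have hc : ContinuousAt (fun q : ℝ × ℝ => q.1 ^ 2 * densScaled b q.1 q.2 /
      (2 * potNumScaled b q.1 q.2)) (1, 0) := by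
    unfold densScaled potNumScaled
    refine ContinuousAt.div (by fun_prop) (by fun_prop) (by simp)
  have h := hc.tendsto.comp (tendsto_one_sub_rpow_nhdsLT hb)
  refine (h.congr' ?_).trans (by simp [densScaled, potNumScaled])
  filter_upwards [Ioo_mem_nhdsLT (show (0 : ℝ) < 1 by norm_num)] with z hz
  exact (weight_eq_scaled hb hz.1 hz.2).symm

/-- H - b carries the factor 1/r and H' the factor 1/((1-z)r). Their quotient therefore supplies the
1 - z needed to control W', and `dweightScaled` vanishes at (1, 0). -/
theorem tendsto_mul_deriv_weight_nhdsLT {b : ℝ} (hb : 1 < b) :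
    Tendsto (fun z => (potRatio b z - b) * (deriv (weight b) z / deriv (potRatio b) z))
      (𝓝[<] 1) (𝓝 0) := by
  have hc : ContinuousAt (fun q : ℝ × ℝ => q.1 * potRemScaled b q.1 q.2 /
      (2 * potNumScaled b q.1 q.2) * dweightScaled b q.1 q.2) (1, 0) := by
    unfold dweightScaled potRemScaled densScaled potNumScaled
    refine ContinuousAt.mul (ContinuousAt.div (by fun_prop) (by fun_prop) (by simp))
      (ContinuousAt.div (by fun_prop) (by fun_prop) (by simp))
  have h := hc.tendsto.comp (tendsto_one_sub_rpow_nhdsLT hb)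
  refine (h.congr' ?_).trans (by simp [dweightScaled, densScaled, potNumScaled])
  filter_upwards [Ioo_mem_nhdsLT (show (0 : ℝ) < 1 by norm_num)] with z hz
  have h1 : 1 - z ≠ 0 := by linarith [hz.2]
  have h2 : (1 - z) ^ (b - 1) ≠ 0 := (Real.rpow_pos_of_pos (by linarith [hz.2]) _).ne'
  have h3 := (potNumScaled_pos hb hz.1 hz.2).ne'
  have h4 := hz.1.ne'
  have h5 : potRatio b z - b = (2 * pot b z - b * z ^ 2) / z ^ 2 := by
    rw [potRatio_of_ne hb h4]
    field_simp
  have h6 : deriv (potRatio b) z = 2 * potNum b z / z ^ 3 := by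
    rw [← cube_mul_deriv_potRatio hb hz.2]
    field_simp
  simp only [Function.comp]
  rw [← one_sub_mul_deriv_weight hb hz.1 hz.2, h5, h6, potRem_eq_scaled hb hz.2,
    potNum_eq_scaled hb hz.2]
  field_simp

/-! ### Inverse functions on intervals -/

theorem strictMonoOn_of_hasDerivAt_pos {f f' : ℝ → ℝ} {s : Set ℝ} (hs : IsOpen s)
    (hc : Convex ℝ s) (hf : ∀ x ∈ s, HasDerivAt f (f' x) x) (hpos : ∀ x ∈ s, 0 < f' x) :
    StrictMonoOn f s := by
  refine strictMonoOn_of_deriv_pos hc (HasDerivAt.continuousOn hf) fun x hx => ?_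
  rw [hs.interior_eq] at hx
  rw [(hf x hx).deriv]
  exact hpos x hx

theorem strictMonoOn_invFunOn {f : ℝ → ℝ} {s t : Set ℝ} (hf : StrictMonoOn f s)
    (ht : t ⊆ f '' s) : StrictMonoOn (Function.invFunOn f s) t := by
  intro x hx y hy hxy
  have h1 := Function.invFunOn_pos (ht hx)
  have h2 := Function.invFunOn_pos (ht hy)
  rw [← h1.2, ← h2.2] at hxy
  exact (hf.lt_iff_lt h1.1 h2.1).1 hxy

/-- A monotone inverse whose image is a neighbourhood is continuous, and continuity is all the
inverse function rule needs besides a nonzero derivative. -/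
theorem hasDerivAt_invFunOn {f f' : ℝ → ℝ} {s : Set ℝ} (hs : IsOpen s)
    (hf : ∀ x ∈ s, HasDerivAt f (f' x) x) (hpos : ∀ x ∈ s, 0 < f' x) (hmono : StrictMonoOn f s)
    {y : ℝ} (hy : f '' s ∈ 𝓝 y) :
    HasDerivAt (Function.invFunOn f s) (f' (Function.invFunOn f s y))⁻¹ y := by
  have hy' : y ∈ f '' s := mem_of_mem_nhds hy
  have h1 := Function.invFunOn_pos hy'
  refine HasDerivAt.of_local_left_inverse ?_ (hf _ h1.1) (hpos _ h1.1).ne' ?_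
  · refine (strictMonoOn_invFunOn hmono subset_rfl).continuousAt_of_image_mem_nhds hy ?_
    refine mem_of_superset (hs.mem_nhds h1.1) fun x hx => ⟨f x, mem_image_of_mem f hx, ?_⟩
    exact hmono.injOn.leftInvOn_invFunOn hx
  · filter_upwards [hy] with x hx
    exact Function.invFunOn_eq hx

/-! ### The inverse of the potential ratio -/

theorem strictMonoOn_potRatio {b : ℝ} (hb : 1 < b) : StrictMonoOn (potRatio b) (Ioo 0 1) :=
  strictMonoOn_of_hasDerivAt_pos isOpen_Ioo (convex_Ioo 0 1)
    (fun _ hx => hasDerivAt_potRatio hx.2) (fun _ hx => deriv_potRatio_pos hb hx.1.le hx.2)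

theorem Ioi_subset_image_potRatio {b : ℝ} (hb : 1 < b) : Ioi b ⊆ potRatio b '' Ioo 0 1 := by
  have h0 : Tendsto (potRatio b) (𝓝[>] 0) (𝓝 b) := by
    have := (analyticAt_potRatio (b := b) one_pos).continuousAt.tendsto
    rw [potRatio_zero hb] at this
    exact this.mono_left nhdsWithin_le_nhds
  exact isPreconnected_Ioo.intermediate_value_Ioi
    (le_principal_iff.2 (Ioo_mem_nhdsGT one_pos)) (le_principal_iff.2 (Ioo_mem_nhdsLT one_pos))
    (HasDerivAt.continuousOn fun x hx => hasDerivAt_potRatio hx.2) h0 (tendsto_potRatio_nhdsLT hb)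

/-- The point `z` of `(0, 1)` at which `potRatio b z = b + y`. -/
noncomputable def potInv (b y : ℝ) : ℝ := Function.invFunOn (potRatio b) (Ioo 0 1) (b + y)

section potInv

variable {b y : ℝ}

theorem potInv_mem (hb : 1 < b) (hy : 0 < y) : potInv b y ∈ Ioo (0 : ℝ) 1 :=
  Function.invFunOn_mem (Ioi_subset_image_potRatio hb (by simpa using hy))

theorem potRatio_potInv (hb : 1 < b) (hy : 0 < y) : potRatio b (potInv b y) = b + y :=
  Function.invFunOn_eq (Ioi_subset_image_potRatio hb (by simpa using hy))

theorem lt_potRatio {z : ℝ} (hb : 1 < b) (hz : z ∈ Ioo (0 : ℝ) 1) : b < potRatio b z :=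
  lt_of_lt_of_le (by have := hz.1; simp; positivity) (add_le_potRatio hb hz.1.le hz.2)

theorem potInv_potRatio {z : ℝ} (hb : 1 < b) (hz : z ∈ Ioo (0 : ℝ) 1) :
    potInv b (potRatio b z - b) = z := by
  rw [potInv, add_sub_cancel]
  exact (strictMonoOn_potRatio hb).injOn.leftInvOn_invFunOn hz

theorem strictMonoOn_potInv (hb : 1 < b) : StrictMonoOn (potInv b) (Ioi 0) := by
  intro x hx y hy hxy
  exact strictMonoOn_invFunOn (strictMonoOn_potRatio hb) (Ioi_subset_image_potRatio hb)
    (by simpa using hx) (by simpa using hy) (by linarith)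

theorem hasDerivAt_potInv (hb : 1 < b) (hy : 0 < y) :
    HasDerivAt (potInv b) (deriv (potRatio b) (potInv b y))⁻¹ y := by
  have h := hasDerivAt_invFunOn isOpen_Ioo (fun x hx => hasDerivAt_potRatio hx.2)
    (fun _ hx => deriv_potRatio_pos hb hx.1.le hx.2) (strictMonoOn_potRatio hb)
    (mem_of_superset (Ioi_mem_nhds (show b < b + y by linarith)) (Ioi_subset_image_potRatio hb))
  exact h.comp_const_add b y

theorem potInv_le (hb : 1 < b) (hy : 0 < y) : potInv b y ≤ 3 / (b * (b + 1)) * y := by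
  have h := potInv_mem hb hy
  have h1 := add_le_potRatio hb h.1.le h.2
  rw [potRatio_potInv hb hy] at h1
  rw [div_mul_eq_mul_div, le_div_iff₀ (by positivity)]
  linarith

theorem tendsto_potInv_atTop (hb : 1 < b) : Tendsto (potInv b) atTop (𝓝[<] 1) := by
  refine tendsto_nhdsWithin_iff.2 ⟨tendsto_order.2 ⟨fun a ha => ?_, fun a ha => ?_⟩, ?_⟩
  -- The maximum with 1/2 keeps the comparison point inside (0,1) when a ≤ 0.
  · have hm : max a (1 / 2) ∈ Ioo (0 : ℝ) 1 :=
      ⟨lt_of_lt_of_le (by norm_num) (le_max_right _ _), max_lt ha (by norm_num)⟩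
    filter_upwards [eventually_gt_atTop (potRatio b (max a (1 / 2)) - b)] with y hy
    have h0 := sub_pos.2 (lt_potRatio hb hm)
    have := strictMonoOn_potInv hb h0 (h0.trans hy) hy
    rw [potInv_potRatio hb hm] at this
    exact (le_max_left _ _).trans_lt this
  · filter_upwards [eventually_gt_atTop 0] with y hy
    exact (potInv_mem hb hy).2.trans ha
  · filter_upwards [eventually_gt_atTop 0] with y hy
    exact (potInv_mem hb hy).2

theorem tendsto_potInv_nhdsGT (hb : 1 < b) : Tendsto (potInv b) (𝓝[>] 0) (𝓝 0) := by
  have h : Tendsto (fun y : ℝ => 3 / (b * (b + 1)) * y) (𝓝[>] 0) (𝓝 0) := by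
    have : Tendsto (fun y : ℝ => 3 / (b * (b + 1)) * y) (𝓝 0) (𝓝 (3 / (b * (b + 1)) * 0)) :=
      (continuous_const.mul continuous_id).tendsto 0
    rw [mul_zero] at this
    exact this.mono_left nhdsWithin_le_nhds
  refine squeeze_zero' ?_ ?_ h
  · filter_upwards [self_mem_nhdsWithin] with y hy
    exact (potInv_mem hb hy).1.le
  · filter_upwards [self_mem_nhdsWithin] with y hy
    exact potInv_le hb hy

/-- A function that is continuous on `[0, 1)` stays bounded along `potInv b` on bounded intervals. -/
theorem exists_bound_comp_potInv (hb : 1 < b) {f : ℝ → ℝ} (hf : ContinuousOn f (Ico 0 1)) (y : ℝ) :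
    ∃ C, 0 < C ∧ ∀ x ∈ Ioc 0 y, |f (potInv b x)| ≤ C := by
  rcases le_or_gt y 0 with hy | hy
  · exact ⟨1, one_pos, fun x hx => absurd (hx.1.trans_le hx.2) hy.not_gt⟩
  · have hm := potInv_mem hb hy
    obtain ⟨C, hC⟩ := isCompact_Icc.exists_bound_of_continuousOn
      (hf.mono (Icc_subset_Ico_right hm.2) : ContinuousOn f (Icc 0 (potInv b y)))
    refine ⟨max C 1, by positivity, fun x hx => le_max_of_le_left (hC _ ⟨?_, ?_⟩)⟩
    · exact (potInv_mem hb hx.1).1.le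
    · exact (strictMonoOn_potInv hb).monotoneOn hx.1 hy hx.2

end potInv

theorem continuousOn_deriv_potRatio (b : ℝ) : ContinuousOn (deriv (potRatio b)) (Ico 0 1) :=
  fun _ hx => (analyticAt_potRatio hx.2).deriv.continuousAt.continuousWithinAt

theorem continuousOn_weight {b : ℝ} (hb : 1 < b) : ContinuousOn (weight b) (Ico 0 1) :=
  fun _ hx => (analyticAt_weight hb hx.1 hx.2).continuousAt.continuousWithinAt

theorem continuousOn_deriv_weight {b : ℝ} (hb : 1 < b) : ContinuousOn (deriv (weight b)) (Ico 0 1) :=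
  fun _ hx => (analyticAt_weight hb hx.1 hx.2).deriv.continuousAt.continuousWithinAt

/-! ### Uniformization of the homoclinic orbit -/

noncomputable section

/-- The height of the normalized profile as a function of the uniformizing parameter `σ ∈ (-1, 1)`. -/
def orbit (b Y σ : ℝ) : ℝ := potInv b (Y * (1 - σ ^ 2))

/-- The reciprocal of the speed at which the uniformizing parameter moves along the orbit. -/
def slowness (b Y σ : ℝ) : ℝ :=
  2 * √(Y * (b + Y)) / (orbit b Y σ * deriv (potRatio b) (orbit b Y σ))

/-- The position `x` as a function of the uniformizing parameter. -/
def position (b Y σ : ℝ) : ℝ := ∫ s in (0 : ℝ)..σ, slowness b Y s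

/-- The uniformizing parameter as a function of the position. -/
def parameter (b Y x : ℝ) : ℝ := Function.invFunOn (position b Y) (Ioo (-1) 1) x

/-- The normalized profile of the solitary wave. -/
def profile (b Y x : ℝ) : ℝ := orbit b Y (parameter b Y x)

end

section orbit

variable {b Y σ : ℝ}

theorem one_sub_sq_pos (hσ : σ ∈ Ioo (-1 : ℝ) 1) : 0 < 1 - σ ^ 2 := by
  nlinarith [hσ.1, hσ.2]

theorem orbit_mem (hb : 1 < b) (hY : 0 < Y) (hσ : σ ∈ Ioo (-1 : ℝ) 1) :
    orbit b Y σ ∈ Ioo (0 : ℝ) 1 :=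
  potInv_mem hb (mul_pos hY (one_sub_sq_pos hσ))

theorem orbit_neg (b Y σ : ℝ) : orbit b Y (-σ) = orbit b Y σ := by simp [orbit]

theorem slowness_neg (b Y σ : ℝ) : slowness b Y (-σ) = slowness b Y σ := by
  simp [slowness, orbit_neg]

theorem hasDerivAt_orbit (hb : 1 < b) (hY : 0 < Y) (hσ : σ ∈ Ioo (-1 : ℝ) 1) :
    HasDerivAt (orbit b Y) (-(2 * Y * σ) / deriv (potRatio b) (orbit b Y σ)) σ := by
  have h1 : HasDerivAt (fun σ : ℝ => Y * (1 - σ ^ 2)) (-(2 * Y * σ)) σ := by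
    convert! ((hasDerivAt_pow 2 σ).const_sub 1).const_mul Y using 1
    simp
    ring
  convert! (hasDerivAt_potInv hb (mul_pos hY (one_sub_sq_pos hσ))).comp σ h1 using 1
  rw [orbit]
  ring

theorem slowness_pos (hb : 1 < b) (hY : 0 < Y) (hσ : σ ∈ Ioo (-1 : ℝ) 1) :
    0 < slowness b Y σ := by
  have h := orbit_mem hb hY hσ
  have h1 := deriv_potRatio_pos hb h.1.le h.2
  have h2 := h.1
  unfold slowness
  positivity

theorem continuousOn_slowness (hb : 1 < b) (hY : 0 < Y) :
    ContinuousOn (slowness b Y) (Ioo (-1) 1) := by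
  have h1 : ContinuousOn (orbit b Y) (Ioo (-1) 1) :=
    HasDerivAt.continuousOn fun σ hσ => hasDerivAt_orbit hb hY hσ
  have h2 : ContinuousOn (fun σ => deriv (potRatio b) (orbit b Y σ)) (Ioo (-1) 1) :=
    (continuousOn_deriv_potRatio b).comp h1
      fun σ hσ => Ioo_subset_Ico_self (orbit_mem hb hY hσ)
  refine continuousOn_const.div (h1.mul h2) fun σ hσ => ?_
  have h := orbit_mem hb hY hσ
  exact (mul_pos h.1 (deriv_potRatio_pos hb h.1.le h.2)).ne'

theorem hasDerivAt_position (hb : 1 < b) (hY : 0 < Y) (hσ : σ ∈ Ioo (-1 : ℝ) 1) :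
    HasDerivAt (position b Y) (slowness b Y σ) σ := by
  have hc := continuousOn_slowness hb hY
  refine intervalIntegral.integral_hasDerivAt_right ?_
    (hc.stronglyMeasurableAtFilter isOpen_Ioo σ hσ) (hc.continuousAt (isOpen_Ioo.mem_nhds hσ))
  refine (hc.mono ?_).intervalIntegrable
  exact ordConnected_Ioo.uIcc_subset (by norm_num) hσ

theorem position_zero (b Y : ℝ) : position b Y 0 = 0 := by simp [position]

theorem position_neg (b Y σ : ℝ) : position b Y (-σ) = -position b Y σ := by
  have h := intervalIntegral.integral_comp_neg (a := 0) (b := σ) (slowness b Y)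
  simp only [slowness_neg, neg_zero] at h
  rw [position, position, h, intervalIntegral.integral_symm]

theorem strictMonoOn_position (hb : 1 < b) (hY : 0 < Y) :
    StrictMonoOn (position b Y) (Ioo (-1) 1) :=
  strictMonoOn_of_hasDerivAt_pos isOpen_Ioo (convex_Ioo _ _)
    (fun _ hσ => hasDerivAt_position hb hY hσ) (fun _ hσ => slowness_pos hb hY hσ)

/-- On the orbit H' is bounded, and z is at most a constant times Y(1 - σ²) ≤ 2Y(1 - σ). This forces
logarithmic divergence of the position, so that the orbit takes infinite time. -/
theorem exists_le_slowness (hb : 1 < b) (hY : 0 < Y) :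
    ∃ C, 0 < C ∧ ∀ σ ∈ Ico (0 : ℝ) 1, C / (1 - σ) ≤ slowness b Y σ := by
  obtain ⟨M, hM, hbd⟩ := exists_bound_comp_potInv hb (continuousOn_deriv_potRatio b) Y
  have hN : 0 < √(Y * (b + Y)) := by positivity
  refine ⟨2 * √(Y * (b + Y)) / (3 / (b * (b + 1)) * (2 * Y) * M), by positivity, fun σ hσ => ?_⟩
  have hσ' : σ ∈ Ioo (-1 : ℝ) 1 := ⟨by linarith [hσ.1], hσ.2⟩
  have h := orbit_mem hb hY hσ'
  have h1 := deriv_potRatio_pos hb h.1.le h.2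
  have hy := mul_pos hY (one_sub_sq_pos hσ')
  have h2 : deriv (potRatio b) (orbit b Y σ) ≤ M :=
    (le_abs_self _).trans (hbd _ ⟨hy, by nlinarith [sq_nonneg σ]⟩)
  have h3 : orbit b Y σ ≤ 3 / (b * (b + 1)) * (2 * Y) * (1 - σ) := by
    refine (potInv_le hb hy).trans ?_
    rw [mul_assoc]
    refine mul_le_mul_of_nonneg_left ?_ (by positivity)
    have := mul_nonneg hY.le (mul_nonneg (sub_nonneg.2 hσ.2.le) (sub_nonneg.2 hσ.2.le))
    nlinarith
  have h4 : 0 < 1 - σ := sub_pos.2 hσ.2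
  rw [slowness, div_div]
  refine div_le_div_of_nonneg_left (by positivity) (mul_pos h.1 h1) ?_
  calc orbit b Y σ * deriv (potRatio b) (orbit b Y σ)
      ≤ 3 / (b * (b + 1)) * (2 * Y) * (1 - σ) * M := by gcongr
    _ = _ := by ring

theorem tendsto_position_nhdsLT (hb : 1 < b) (hY : 0 < Y) :
    Tendsto (position b Y) (𝓝[<] 1) atTop := by
  obtain ⟨C, hC, hle⟩ := exists_le_slowness hb hY
  have h1 : Tendsto (fun σ : ℝ => C * -Real.log (1 - σ)) (𝓝[<] 1) atTop :=
    ((tendsto_neg_atBot_atTop.comp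
      (Real.tendsto_log_nhdsGT_zero.comp tendsto_one_sub_nhdsLT))).const_mul_atTop hC
  refine tendsto_atTop_mono' _ ?_ h1
  filter_upwards [Ioo_mem_nhdsLT (show (0 : ℝ) < 1 by norm_num)] with σ hσ
  have hd : ∀ s ∈ Icc 0 σ, HasDerivAt (fun s => position b Y s + C * Real.log (1 - s))
      (slowness b Y s - C / (1 - s)) s := by
    intro s hs
    have hs1 : s < 1 := hs.2.trans_lt hσ.2
    have he : HasDerivAt (fun s : ℝ => 1 - s) (-1) s := (hasDerivAt_id s).const_sub 1
    convert! (hasDerivAt_position hb hY ⟨by linarith [hs.1], hs1⟩).add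
      ((he.log (by linarith)).const_mul C) using 1
    ring
  have := le_of_hasDerivAt_nonneg hσ.1.le hd fun s hs =>
    sub_nonneg.2 (hle s ⟨hs.1, hs.2.trans_lt hσ.2⟩)
  simp [position_zero] at this
  linarith

theorem image_position (hb : 1 < b) (hY : 0 < Y) : position b Y '' Ioo (-1) 1 = univ := by
  refine eq_univ_of_univ_subset ?_
  have h1 := tendsto_position_nhdsLT hb hY
  have h2 : Tendsto (position b Y) (𝓝[>] (-1)) atBot := by
    have h3 : Tendsto (fun σ : ℝ => -σ) (𝓝[>] (-1)) (𝓝[<] 1) := by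
      simpa using tendsto_neg_nhdsGT (a := (-1 : ℝ))
    refine (tendsto_neg_atTop_atBot.comp (h1.comp h3)).congr fun σ => ?_
    simp [position_neg]
  exact isPreconnected_Ioo.intermediate_value_Iii
    (le_principal_iff.2 (Ioo_mem_nhdsGT (by norm_num)))
    (le_principal_iff.2 (Ioo_mem_nhdsLT (by norm_num)))
    (HasDerivAt.continuousOn fun _ hσ => hasDerivAt_position hb hY hσ) h2 h1

theorem parameter_mem (hb : 1 < b) (hY : 0 < Y) (x : ℝ) : parameter b Y x ∈ Ioo (-1 : ℝ) 1 :=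
  Function.invFunOn_mem (f := position b Y) (by
    have := mem_univ x
    rwa [← image_position hb hY] at this)

theorem parameter_position (hb : 1 < b) (hY : 0 < Y) (hσ : σ ∈ Ioo (-1 : ℝ) 1) :
    parameter b Y (position b Y σ) = σ :=
  (strictMonoOn_position hb hY).injOn.leftInvOn_invFunOn hσ

theorem strictMono_parameter (hb : 1 < b) (hY : 0 < Y) : StrictMono (parameter b Y) := by
  have := strictMonoOn_invFunOn (strictMonoOn_position hb hY) (image_position hb hY).ge
  exact strictMonoOn_univ.1 this

theorem hasDerivAt_parameter (hb : 1 < b) (hY : 0 < Y) (x : ℝ) :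
    HasDerivAt (parameter b Y) (slowness b Y (parameter b Y x))⁻¹ x :=
  hasDerivAt_invFunOn isOpen_Ioo (fun _ hσ => hasDerivAt_position hb hY hσ)
    (fun _ hσ => slowness_pos hb hY hσ) (strictMonoOn_position hb hY)
    (by rw [image_position hb hY]; exact univ_mem)

theorem tendsto_parameter_atTop (hb : 1 < b) (hY : 0 < Y) :
    Tendsto (parameter b Y) atTop (𝓝 1) := by
  refine tendsto_order.2 ⟨fun a ha => ?_, fun a ha => ?_⟩
  · have hm : max a 0 ∈ Ioo (-1 : ℝ) 1 :=
      ⟨lt_of_lt_of_le (by norm_num) (le_max_right _ _), max_lt ha one_pos⟩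
    filter_upwards [eventually_gt_atTop (position b Y (max a 0))] with x hx
    have := strictMono_parameter hb hY hx
    rw [parameter_position hb hY hm] at this
    exact (le_max_left _ _).trans_lt this
  · exact Eventually.of_forall fun x => (parameter_mem hb hY x).2.trans ha

theorem tendsto_parameter_atBot (hb : 1 < b) (hY : 0 < Y) :
    Tendsto (parameter b Y) atBot (𝓝 (-1)) := by
  refine tendsto_order.2 ⟨fun a ha => ?_, fun a ha => ?_⟩
  · exact Eventually.of_forall fun x => ha.trans (parameter_mem hb hY x).1
  · have hm : min a 0 ∈ Ioo (-1 : ℝ) 1 :=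
      ⟨lt_min ha (by norm_num), lt_of_le_of_lt (min_le_right _ _) (by norm_num)⟩
    filter_upwards [eventually_lt_atBot (position b Y (min a 0))] with x hx
    have := strictMono_parameter hb hY hx
    rw [parameter_position hb hY hm] at this
    exact this.trans_le (min_le_left _ _)

theorem parameter_zero (hb : 1 < b) (hY : 0 < Y) : parameter b Y 0 = 0 := by
  have := parameter_position hb hY (σ := 0) (by norm_num)
  rwa [position_zero] at this

theorem profile_mem (hb : 1 < b) (hY : 0 < Y) (x : ℝ) : profile b Y x ∈ Ioo (0 : ℝ) 1 :=
  orbit_mem hb hY (parameter_mem hb hY x)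

theorem profile_zero (hb : 1 < b) (hY : 0 < Y) : profile b Y 0 = potInv b Y := by
  simp [profile, parameter_zero hb hY, orbit]

theorem tendsto_profile_of_sq (hb : 1 < b) (hY : 0 < Y) {l : Filter ℝ}
    (h : Tendsto (fun x => parameter b Y x ^ 2) l (𝓝 1)) : Tendsto (profile b Y) l (𝓝 0) := by
  refine (tendsto_potInv_nhdsGT hb).comp (tendsto_nhdsWithin_iff.2 ⟨?_, ?_⟩)
  · have := (h.const_sub 1).const_mul Y
    simpa using this
  · exact Eventually.of_forall fun x => mul_pos hY (one_sub_sq_pos (parameter_mem hb hY x))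

theorem tendsto_profile_atTop (hb : 1 < b) (hY : 0 < Y) : Tendsto (profile b Y) atTop (𝓝 0) :=
  tendsto_profile_of_sq hb hY (by simpa using (tendsto_parameter_atTop hb hY).pow 2)

theorem tendsto_profile_atBot (hb : 1 < b) (hY : 0 < Y) : Tendsto (profile b Y) atBot (𝓝 0) :=
  tendsto_profile_of_sq hb hY (by simpa using (tendsto_parameter_atBot hb hY).pow 2)

/-- The factor H' cancels between dz/dσ and dσ/dx, leaving the energy law with its square root
already resolved. -/
theorem hasDerivAt_profile (hb : 1 < b) (hY : 0 < Y) (x : ℝ) :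
    HasDerivAt (profile b Y) (-(Y / √(Y * (b + Y))) * (parameter b Y x * profile b Y x)) x := by
  have hm := parameter_mem hb hY x
  have ho := orbit_mem hb hY hm
  have h1 := (deriv_potRatio_pos hb ho.1.le ho.2).ne'
  have h2 := ho.1.ne'
  have hN : √(Y * (b + Y)) ≠ 0 := by positivity
  convert! (hasDerivAt_orbit hb hY hm).comp x (hasDerivAt_parameter hb hY x) using 1
  rw [slowness, profile]
  field_simp

theorem hasDerivAt_deriv_profile (hb : 1 < b) (hY : 0 < Y) (x : ℝ) :
    HasDerivAt (fun x => -(Y / √(Y * (b + Y))) * (parameter b Y x * profile b Y x))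
      (profile b Y x - (b + Y)⁻¹ * dpot b (profile b Y x)) x := by
  have hm := parameter_mem hb hY x
  have ho := orbit_mem hb hY hm
  have h1 := (deriv_potRatio_pos hb ho.1.le ho.2).ne'
  have h2 := ho.1.ne'
  have hN : √(Y * (b + Y)) ≠ 0 := by positivity
  have hN2 : √(Y * (b + Y)) ^ 2 = Y * (b + Y) := Real.sq_sqrt (by positivity)
  convert! ((hasDerivAt_parameter hb hY x).mul (hasDerivAt_profile hb hY x)).const_mul
    (-(Y / √(Y * (b + Y)))) using 1
  have h3 : potRatio b (profile b Y x) = b + Y * (1 - parameter b Y x ^ 2) :=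
    potRatio_potInv hb (mul_pos hY (one_sub_sq_pos hm))
  have hs : slowness b Y (parameter b Y x) =
      2 * √(Y * (b + Y)) / (profile b Y x * deriv (potRatio b) (profile b Y x)) := rfl
  rw [dpot_eq hb (profile_mem hb hY x).2, h3, hs]
  change deriv (potRatio b) (profile b Y x) ≠ 0 at h1
  change profile b Y x ≠ 0 at h2
  have hbY : b + Y ≠ 0 := by positivity
  generalize profile b Y x = z at *
  generalize √(Y * (b + Y)) = N at *
  -- The middle term is the second derivative with Y/N² = 1/(b+Y) pulled out, so that N² is replaced
  -- on one side only.
  trans Y / N ^ 2 * (-(z ^ 2 * deriv (potRatio b) z / 2) + Y * parameter b Y x ^ 2 * z)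
  · rw [hN2]
    field_simp
    ring
  · field_simp
    ring

end orbit

/-- The Jacobian has zH' in its denominator and the density equals W·zH', so the singularities at σ
= ±1 cancel. -/
theorem slowness_mul_dens_orbit {b Y σ : ℝ} (hb : 1 < b) (hY : 0 < Y) (hσ : σ ∈ Ioo (-1 : ℝ) 1) :
    |slowness b Y σ| • dens b (profile b Y (position b Y σ)) =
      2 * √(Y * (b + Y)) * weight b (orbit b Y σ) := by
  have ho := orbit_mem hb hY hσ
  have h1 := (deriv_potRatio_pos hb ho.1.le ho.2).ne'
  have h2 := ho.1.ne'
  rw [abs_of_pos (slowness_pos hb hY hσ), profile, parameter_position hb hY hσ,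
    dens_eq_weight hb ho.1 ho.2, slowness, smul_eq_mul]
  field_simp

theorem continuousOn_comp_orbit {b Y : ℝ} (hb : 1 < b) (hY : 0 < Y) {f : ℝ → ℝ}
    (hf : ContinuousOn f (Ico 0 1)) : ContinuousOn (fun σ => f (orbit b Y σ)) (Ioo (-1) 1) :=
  hf.comp (HasDerivAt.continuousOn fun _ hσ => hasDerivAt_orbit hb hY hσ)
    fun _ hσ => Ioo_subset_Ico_self (orbit_mem hb hY hσ)

theorem integrableOn_comp_orbit {b Y : ℝ} (hb : 1 < b) (hY : 0 < Y) {f : ℝ → ℝ}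
    (hf : ContinuousOn f (Ico 0 1)) : IntegrableOn (fun σ => f (orbit b Y σ)) (Ioo (-1) 1) := by
  obtain ⟨C, -, hbd⟩ := exists_bound_comp_potInv hb hf Y
  refine IntegrableOn.of_bound (by simp)
    ((continuousOn_comp_orbit hb hY hf).aestronglyMeasurable measurableSet_Ioo) C ?_
  refine (ae_restrict_iff' measurableSet_Ioo).2 (Eventually.of_forall fun σ hσ => ?_)
  exact hbd _ ⟨mul_pos hY (one_sub_sq_pos hσ), by nlinarith [sq_nonneg σ]⟩

theorem integrable_dens_profile {b Y : ℝ} (hb : 1 < b) (hY : 0 < Y) :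
    Integrable fun x => dens b (profile b Y x) := by
  rw [← integrableOn_univ, ← image_position hb hY,
    integrableOn_image_iff_integrableOn_abs_deriv_smul measurableSet_Ioo
      (fun _ hσ => (hasDerivAt_position hb hY hσ).hasDerivWithinAt)
      (strictMonoOn_position hb hY).injOn]
  refine IntegrableOn.congr_fun ?_ (fun σ hσ => (slowness_mul_dens_orbit hb hY hσ).symm)
    measurableSet_Ioo
  exact (integrableOn_comp_orbit hb hY (continuousOn_weight hb)).const_mul _

theorem integral_dens_profile {b Y : ℝ} (hb : 1 < b) (hY : 0 < Y) :
    ∫ x, dens b (profile b Y x) =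
      2 * √(Y * (b + Y)) * ∫ σ in Ioo (-1) 1, weight b (orbit b Y σ) := by
  rw [← setIntegral_univ, ← image_position hb hY,
    integral_image_eq_integral_abs_deriv_smul measurableSet_Ioo
      (fun _ hσ => (hasDerivAt_position hb hY hσ).hasDerivWithinAt)
      (strictMonoOn_position hb hY).injOn, ← integral_const_mul]
  exact setIntegral_congr_fun measurableSet_Ioo fun σ hσ => slowness_mul_dens_orbit hb hY hσ

/-! ### The profile solves the equation of the solitary wave -/

/-- Bootstrap: if z and w are C^n, then so are their derivatives w and g ∘ z. -/
theorem contDiff_of_hasDerivAt_hasDerivAt {z w g : ℝ → ℝ} (hz : ∀ x, HasDerivAt z (w x) x)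
    (hw : ∀ x, HasDerivAt w (g (z x)) x) (hg : ∀ x, ContDiffAt ℝ ∞ g (z x)) : ContDiff ℝ ∞ z := by
  have hz' : deriv z = w := funext fun x => (hz x).deriv
  have hw' : deriv w = g ∘ z := funext fun x => (hw x).deriv
  have key : ∀ n : ℕ, ContDiff ℝ n z ∧ ContDiff ℝ n w := by
    intro n
    induction n with
    | zero =>
      refine ⟨contDiff_zero.2 ?_, contDiff_zero.2 ?_⟩
      · exact continuous_iff_continuousAt.2 fun x => (hz x).continuousAt
      · exact continuous_iff_continuousAt.2 fun x => (hw x).continuousAt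
    | succ n ih =>
      push_cast
      refine ⟨contDiff_succ_iff_deriv.2 ⟨fun x => (hz x).differentiableAt, by simp, ?_⟩,
        contDiff_succ_iff_deriv.2 ⟨fun x => (hw x).differentiableAt, by simp, ?_⟩⟩
      · rw [hz']
        exact ih.2
      · rw [hw']
        refine contDiff_iff_contDiffAt.2 fun x => ?_
        exact ((hg x).of_le (by exact_mod_cast le_top)).comp x ih.1.contDiffAt
  exact contDiff_infty.2 fun n => (key n).1

theorem iteratedDeriv_two_eq {f f₁ f₂ : ℝ → ℝ} (h₁ : ∀ x, HasDerivAt f (f₁ x) x)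
    (h₂ : ∀ x, HasDerivAt f₁ (f₂ x) x) : iteratedDeriv 2 f = f₂ := by
  have e₁ : deriv f = f₁ := funext fun x => (h₁ x).deriv
  have e₂ : deriv f₁ = f₂ := funext fun x => (h₂ x).deriv
  rw [iteratedDeriv_succ, iteratedDeriv_one, e₁, e₂]

theorem hasDerivAt_force (b κ : ℝ) {z : ℝ} (hz : z < 1) :
    HasDerivAt (fun z => z - κ * dpot b z) (1 - κ * (b * (1 - z) ^ (-b - 1))) z :=
  (hasDerivAt_id z).sub ((hasDerivAt_dpot b hz).const_mul κ)

theorem analyticAt_force (b κ : ℝ) {z : ℝ} (hz : z < 1) :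
    AnalyticAt ℝ (fun z => z - κ * dpot b z) z :=
  analyticAt_id.sub (analyticAt_const.mul ((analyticAt_one_sub_rpow (-b) hz).sub analyticAt_const))

/-- The amplitude parameter `Y` belonging to the background `k`. -/
noncomputable def amplitude (b c k : ℝ) : ℝ := (c - k) / k - b

theorem lt_of_mem_background {b c k : ℝ} (hb : 1 < b) (hk : k ∈ Ioo 0 (c / (b + 1))) :
    k * (b + 1) < c ∧ k < c := by
  have h := (lt_div_iff₀ (by linarith)).1 hk.2
  exact ⟨h, by nlinarith [hk.1]⟩

theorem amplitude_pos {b c k : ℝ} (hb : 1 < b) (hk : k ∈ Ioo 0 (c / (b + 1))) :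
    0 < amplitude b c k := by
  have h := (lt_of_mem_background hb hk).1
  rw [amplitude, sub_pos, lt_div_iff₀ hk.1]
  linarith

theorem inv_add_amplitude (b c k : ℝ) : (b + amplitude b c k)⁻¹ = k / (c - k) := by
  rw [amplitude, add_sub_cancel, inv_div]

/-- Differentiating z'' = z - κh'(z) once and using (1-z)^(-b-1) = (1-z)^(-b)/(1-z) makes the power
cancel from the third-order equation. -/
theorem isSolitaryWave_profile {b c k : ℝ} (hb : 1 < b) (hk : k ∈ Ioo 0 (c / (b + 1))) :
    IsSolitaryWave b c k fun x => k + (c - k) * profile b (amplitude b c k) x := by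
  have hY := amplitude_pos hb hk
  have hck : c - k ≠ 0 := by linarith [(lt_of_mem_background hb hk).2]
  have hκ := inv_add_amplitude b c k
  set Y := amplitude b c k
  set w : ℝ → ℝ := fun x => -(Y / √(Y * (b + Y))) * (parameter b Y x * profile b Y x) with hw
  have h₁ : ∀ x, HasDerivAt (profile b Y) (w x) x := hasDerivAt_profile hb hY
  have h₂ : ∀ x, HasDerivAt w (profile b Y x - k / (c - k) * dpot b (profile b Y x)) x := by
    rw [← hκ]
    exact hasDerivAt_deriv_profile hb hY
  have h₃ : ∀ x, HasDerivAt (fun x => profile b Y x - k / (c - k) * dpot b (profile b Y x))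
      ((1 - k / (c - k) * (b * (1 - profile b Y x) ^ (-b - 1))) * w x) x := fun x =>
    (hasDerivAt_force b (k / (c - k)) (profile_mem hb hY x).2).comp x (h₁ x)
  have hφ₁ : ∀ x, HasDerivAt (fun x => k + (c - k) * profile b Y x) ((c - k) * w x) x :=
    fun x => ((h₁ x).const_mul (c - k)).const_add k
  have hφ₂ : ∀ x, HasDerivAt (fun x => (c - k) * w x)
      ((c - k) * (profile b Y x - k / (c - k) * dpot b (profile b Y x))) x :=
    fun x => (h₂ x).const_mul (c - k)
  have hφ₃ := fun x => (h₃ x).const_mul (c - k)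
  have hz : ContDiff ℝ ∞ (profile b Y) :=
    contDiff_of_hasDerivAt_hasDerivAt (g := fun z => z - k / (c - k) * dpot b z) h₁ h₂
      fun x => (analyticAt_force _ _ (profile_mem hb hY x).2).contDiffAt
  refine ⟨contDiff_const.add (contDiff_const.mul hz), fun x => ?_, ?_, ?_, ?_, 0, ?_⟩
  · rw [iteratedDeriv_succ, iteratedDeriv_two_eq hφ₁ hφ₂, (hφ₁ x).deriv, (hφ₃ x).deriv]
    simp only [dpot]
    have h1 : 1 - profile b Y x ≠ 0 := by linarith [(profile_mem hb hY x).2]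
    rw [Real.rpow_sub_one h1]
    field_simp
    ring
  · rw [(hφ₁ 0).deriv, hw]
    simp [parameter_zero hb hY]
  · simpa using ((tendsto_profile_atTop hb hY).const_mul (c - k)).const_add k
  · simpa using ((tendsto_profile_atBot hb hY).const_mul (c - k)).const_add k
  · have := (profile_mem hb hY 0).1.ne'
    simp [hck, this]

/-! ### Uniqueness of the solitary wave -/

theorem exists_hasDerivAt_eq_sub {u u' : ℝ → ℝ} (hu : ∀ x, HasDerivAt u (u' x) x) (x : ℝ) :
    ∃ ξ, x ≤ ξ ∧ u' ξ = u (x + 1) - u x := by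
  obtain ⟨ξ, hξ, h⟩ := exists_hasDerivAt_eq_slope u u' (lt_add_one x)
    (HasDerivAt.continuousOn fun x _ => hu x) fun x _ => hu x
  exact ⟨ξ, hξ.1.le, by simpa using h⟩

/-- If `u` converges at infinity and `F ∘ u'` converges, then the limit of `F ∘ u'` is `F 0`. -/
theorem limit_comp_deriv_eq {u u' F : ℝ → ℝ} {l L : ℝ} (hu : ∀ x, HasDerivAt u (u' x) x)
    (hl : Tendsto u atTop (𝓝 l)) (hF : Continuous F)
    (hL : Tendsto (fun x => F (u' x)) atTop (𝓝 L)) : L = F 0 := by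
  choose ξ hξ hu' using exists_hasDerivAt_eq_sub hu
  have h1 : Tendsto (fun x => F (u' (ξ x))) atTop (𝓝 L) :=
    hL.comp (tendsto_atTop_mono hξ tendsto_id)
  have h2 : Tendsto (fun x => u (x + 1) - u x) atTop (𝓝 0) := by
    simpa using (hl.comp (tendsto_atTop_add_const_right atTop (1 : ℝ) tendsto_id)).sub hl
  simp only [hu'] at h1
  exact tendsto_nhds_unique h1 ((hF.tendsto 0).comp h2)

/-- The unit difference of u tends to 0, while its derivative u'(x+1) - u'(x) = u''(ξ) tends to L; a
convergent function cannot have a derivative with nonzero limit. -/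
theorem limit_second_deriv_eq_zero {u u' u'' : ℝ → ℝ} {l L : ℝ} (hu : ∀ x, HasDerivAt u (u' x) x)
    (hu' : ∀ x, HasDerivAt u' (u'' x) x) (hl : Tendsto u atTop (𝓝 l))
    (hL : Tendsto u'' atTop (𝓝 L)) : L = 0 := by
  choose ξ hξ hξ' using exists_hasDerivAt_eq_sub hu'
  have h1 : Tendsto (fun x => u' (x + 1) - u' x) atTop (𝓝 L) := by
    simp only [← hξ']
    exact hL.comp (tendsto_atTop_mono hξ tendsto_id)
  have h2 : Tendsto (fun x => u (x + 1) - u x) atTop (𝓝 0) := by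
    simpa using (hl.comp (tendsto_atTop_add_const_right atTop (1 : ℝ) tendsto_id)).sub hl
  exact limit_comp_deriv_eq (F := id) (fun x => ((hu (x + 1)).comp_add_const x 1).sub (hu x)) h2
    continuous_id h1

theorem eq_of_hasDerivAt_zero {f : ℝ → ℝ} {a b : ℝ} (hab : a ≤ b)
    (hf : ∀ x ∈ Icc a b, HasDerivAt f 0 x) : f a = f b :=
  le_antisymm (le_of_hasDerivAt_nonneg hab hf fun _ _ => le_rfl)
    (neg_le_neg_iff.1 (le_of_hasDerivAt_nonneg (f := fun x => -f x) (f' := fun _ => 0) hab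
      (fun x hx => by simpa using (hf x hx).fun_neg) fun _ _ => le_rfl))

namespace IsSolitaryWave

variable {b c k : ℝ} {φ : ℝ → ℝ}

theorem hasDerivAt_iteratedDeriv (h : IsSolitaryWave b c k φ) (n : ℕ) (x : ℝ) :
    HasDerivAt (iteratedDeriv n φ) (iteratedDeriv (n + 1) φ x) x := by
  rw [iteratedDeriv_succ]
  exact ((h.smooth.differentiable_iteratedDeriv n (by exact_mod_cast ENat.natCast_lt_top n)) x).hasDerivAt

theorem hasDerivAt (h : IsSolitaryWave b c k φ) (x : ℝ) : HasDerivAt φ (deriv φ x) x := by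
  simpa using h.hasDerivAt_iteratedDeriv 0 x

theorem hasDerivAt_deriv (h : IsSolitaryWave b c k φ) (x : ℝ) :
    HasDerivAt (deriv φ) (iteratedDeriv 2 φ x) x := by
  simpa using h.hasDerivAt_iteratedDeriv 1 x

/-- The momentum times `(c - φ) ^ b` is constant where the wave stays below `c`. -/
theorem momentum_eq_of_Ioi (hkc : k < c) (h : IsSolitaryWave b c k φ) {s : ℝ}
    (hs : ∀ x, s < x → φ x < c) {x : ℝ} (hx : s < x) :
    (φ x - iteratedDeriv 2 φ x) * (c - φ x) ^ b = k * (c - k) ^ b := by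
  have hd : ∀ x, s < x →
      HasDerivAt (fun x => (φ x - iteratedDeriv 2 φ x) * (c - φ x) ^ b) 0 x := by
    intro x hx
    have hpos : 0 < c - φ x := sub_pos.2 (hs x hx)
    convert! ((h.hasDerivAt x).sub (h.hasDerivAt_iteratedDeriv 2 x)).mul
      (((h.hasDerivAt x).const_sub c).rpow_const (p := b) (Or.inl hpos.ne')) using 1
    have ho := h.ode x
    have hr : (c - φ x) ^ b = (c - φ x) ^ (b - 1) * (c - φ x) := by
      rw [Real.rpow_sub_one hpos.ne']
      field_simp
    rw [hr]
    simp only [Pi.sub_apply]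
    -- The derivative of the momentum product is the equation itself times the integrating factor (c
    -- - φ)^(b-1).
    linear_combination -(c - φ x) ^ (b - 1) * ho
  set C := (φ x - iteratedDeriv 2 φ x) * (c - φ x) ^ b with hC
  have hconst : ∀ y, x ≤ y → iteratedDeriv 2 φ y = φ y - C * (c - φ y) ^ (-b) := by
    intro y hy
    have hpos : 0 < c - φ y := sub_pos.2 (hs y (hx.trans_le hy))
    have h1 : C = (φ y - iteratedDeriv 2 φ y) * (c - φ y) ^ b :=
      eq_of_hasDerivAt_zero hy fun t ht => hd t (hx.trans_le ht.1)
    have h2 : (c - φ y) ^ b * (c - φ y) ^ (-b) = 1 := by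
      rw [← Real.rpow_add hpos, add_neg_cancel, Real.rpow_zero]
    rw [h1, mul_assoc, h2]
    ring
  have hkc' : 0 < c - k := sub_pos.2 hkc
  have hlim : Tendsto (fun y => φ y - C * (c - φ y) ^ (-b)) atTop
      (𝓝 (k - C * (c - k) ^ (-b))) :=
    h.tendsto_atTop.sub (((h.tendsto_atTop.const_sub c).rpow_const (Or.inl hkc'.ne')).const_mul C)
  have hlim2 : Tendsto (iteratedDeriv 2 φ) atTop (𝓝 (k - C * (c - k) ^ (-b))) := by
    refine hlim.congr' ?_
    filter_upwards [eventually_ge_atTop x] with y hy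
    exact (hconst y hy).symm
  -- Since φ'' converges its limit must be 0, and this determines the constant C.
  have h0 := limit_second_deriv_eq_zero h.hasDerivAt h.hasDerivAt_deriv h.tendsto_atTop hlim2
  rw [Real.rpow_neg hkc'.le] at h0
  have h3 : (c - k) ^ b ≠ 0 := (Real.rpow_pos_of_pos hkc' b).ne'
  field_simp at h0
  linarith

/-- If φ reached c, there would be a last such point. To its right the momentum product equals
k(c-k)^b > 0, yet by continuity it vanishes at that point. -/
theorem lt_speed (hb : 1 < b) (hk : 0 < k) (hkc : k < c) (h : IsSolitaryWave b c k φ) (x : ℝ) :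
    φ x < c := by
  by_contra hx
  have hcont : Continuous φ := h.smooth.continuous
  set S := {x | c ≤ φ x} with hS
  have hclosed : IsClosed S := isClosed_le continuous_const hcont
  have hbdd : BddAbove S := by
    obtain ⟨y, hy⟩ := eventually_atTop.1 (h.tendsto_atTop.eventually (gt_mem_nhds hkc))
    exact ⟨y, fun t ht => le_of_not_gt fun hyt => absurd (hy t hyt.le) (not_lt.2 ht)⟩
  have hmem : sSup S ∈ S := hclosed.csSup_mem ⟨x, not_lt.1 hx⟩ hbdd
  have hlt : ∀ y, sSup S < y → φ y < c := fun y hy => by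
    by_contra hcon
    exact absurd (le_csSup hbdd (not_lt.1 hcon)) (not_le.2 hy)
  have hE : Continuous fun x => (φ x - iteratedDeriv 2 φ x) * (c - φ x) ^ b := by
    refine (hcont.sub ?_).mul ((continuous_const.sub hcont).rpow_const fun _ => Or.inr (by linarith))
    exact continuous_iff_continuousAt.2 fun x => (h.hasDerivAt_iteratedDeriv 2 x).continuousAt
  have hright : Tendsto φ (𝓝[>] sSup S) (𝓝 (φ (sSup S))) :=
    (hcont.tendsto _).mono_left nhdsWithin_le_nhds
  have heq : φ (sSup S) = c := by
    refine le_antisymm (le_of_tendsto hright ?_) hmem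
    filter_upwards [self_mem_nhdsWithin] with y hy
    exact (hlt y hy).le
  have hlim := (hE.tendsto (sSup S)).mono_left (nhdsWithin_le_nhds (s := Ioi (sSup S)))
  have hconst : (fun _ : ℝ => k * (c - k) ^ b) =ᶠ[𝓝[>] sSup S]
      fun x => (φ x - iteratedDeriv 2 φ x) * (c - φ x) ^ b := by
    filter_upwards [self_mem_nhdsWithin] with y hy
    exact (h.momentum_eq_of_Ioi hkc hlt hy).symm
  have := tendsto_nhds_unique (tendsto_const_nhds.congr' hconst) hlim
  rw [heq, sub_self, Real.zero_rpow (by linarith), mul_zero] at this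
  exact (mul_pos hk (Real.rpow_pos_of_pos (sub_pos.2 hkc) b)).ne' this

end IsSolitaryWave

/-- For z ≤ 0 one has h'' = b(1-z)^(-b-1) ≤ b. This rules out a turning point below the background.
-/
theorem two_mul_pot_le_of_nonpos {b z : ℝ} (hb : 1 < b) (hz : z ≤ 0) : 2 * pot b z ≤ b * z ^ 2 := by
  have h1 : ∀ x ≤ 0, b * x ≤ dpot b x := by
    intro x hx
    have := le_of_hasDerivAt_nonneg (f := fun x => b * x - dpot b x)
      (f' := fun x => b - b * (1 - x) ^ (-b - 1)) hx
      (fun t ht => by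
        simpa using ((hasDerivAt_id t).const_mul b).fun_sub (hasDerivAt_dpot b (by linarith [ht.2])))
      (fun t ht => by
        have := Real.rpow_le_one_of_one_le_of_nonpos (x := 1 - t) (z := -b - 1)
          (by linarith [ht.2]) (by linarith)
        nlinarith)
    simp [dpot_zero] at this
    linarith
  have := le_of_hasDerivAt_nonneg (f := fun x => 2 * pot b x - b * x ^ 2)
    (f' := fun x => 2 * (dpot b x - b * x)) hz
    (fun t ht => by
      convert! ((hasDerivAt_pot hb (by linarith [ht.2])).const_mul 2).sub
        ((hasDerivAt_pow 2 t).const_mul b) using 1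
      simp
      ring)
    (fun t ht => by linarith [h1 t ht.2])
  simp [pot_zero] at this
  linarith

/-- Solutions of `z'' = z - κ h'(z)` that stay below `1` are determined by their data at `0`. -/
theorem eq_of_normalized_ode {b κ : ℝ} {z₁ z₂ w₁ w₂ : ℝ → ℝ} (hz₁ : ∀ x, HasDerivAt z₁ (w₁ x) x)
    (hw₁ : ∀ x, HasDerivAt w₁ (z₁ x - κ * dpot b (z₁ x)) x) (h₁ : ∀ x, z₁ x < 1)
    (hz₂ : ∀ x, HasDerivAt z₂ (w₂ x) x)
    (hw₂ : ∀ x, HasDerivAt w₂ (z₂ x - κ * dpot b (z₂ x)) x) (h₂ : ∀ x, z₂ x < 1)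
    (hz : z₁ 0 = z₂ 0) (hw : w₁ 0 = w₂ 0) : z₁ = z₂ := by
  have hrange : ∀ z w : ℝ → ℝ, (∀ x, HasDerivAt z (w x) x) → (∀ x, z x < 1) → ∀ T : ℝ, 0 < T →
      ∃ m M, M < 1 ∧ ∀ x ∈ Icc (-T) T, m ≤ z x ∧ z x ≤ M := by
    intro z w hz h1 T hT
    have hc : ContinuousOn z (Icc (-T) T) := HasDerivAt.continuousOn fun x _ => hz x
    have hne : (Icc (-T) T).Nonempty := ⟨0, by constructor <;> linarith⟩
    obtain ⟨p, -, hp⟩ := isCompact_Icc.exists_isMinOn hne hc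
    obtain ⟨q, -, hq⟩ := isCompact_Icc.exists_isMaxOn hne hc
    exact ⟨z p, z q, h1 q, fun x hx => ⟨hp hx, hq hx⟩⟩
  ext t
  -- The force is singular at 1, so a Lipschitz constant is available only on the compact range over
  -- a bounded time interval; radius |t| + 1 puts t in its interior.
  have hT : 0 < |t| + 1 := by positivity
  obtain ⟨m₁, M₁, hM₁, hb₁⟩ := hrange z₁ w₁ hz₁ h₁ _ hT
  obtain ⟨m₂, M₂, hM₂, hb₂⟩ := hrange z₂ w₂ hz₂ h₂ _ hT
  have hM : max M₁ M₂ < 1 := max_lt hM₁ hM₂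
  obtain ⟨K, hK⟩ : ∃ K, LipschitzOnWith K (fun z => z - κ * dpot b z)
      (Icc (min m₁ m₂) (max M₁ M₂)) := by
    have hlt : ∀ z ∈ Icc (min m₁ m₂) (max M₁ M₂), z < 1 := fun z hz => hz.2.trans_lt hM
    obtain ⟨C, hC⟩ := isCompact_Icc.exists_bound_of_continuousOn
      (f := fun z : ℝ => deriv (fun z => z - κ * dpot b z) z) (fun z hz =>
      (analyticAt_force b κ (hlt z hz)).deriv.continuousAt.continuousWithinAt)
    refine ⟨C.toNNReal, Convex.lipschitzOnWith_of_nnnorm_deriv_le (fun z hz =>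
      (hasDerivAt_force b κ (hlt z hz)).differentiableAt) (fun z hz => ?_) (convex_Icc _ _)⟩
    rw [← NNReal.coe_le_coe, coe_nnnorm]
    exact (hC z hz).trans (Real.le_coe_toNNReal C)
  have hv : LipschitzOnWith (max 1 K) (fun q : ℝ × ℝ => (q.2, q.1 - κ * dpot b q.1))
      (Icc (min m₁ m₂) (max M₁ M₂) ×ˢ univ) := by
    refine LipschitzOnWith.prodMk LipschitzWith.prod_snd.lipschitzOnWith ?_
    have hfst : LipschitzOnWith 1 (Prod.fst : ℝ × ℝ → ℝ)
        (Icc (min m₁ m₂) (max M₁ M₂) ×ˢ univ) := LipschitzWith.prod_fst.lipschitzOnWith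
    have := LipschitzOnWith.comp hK hfst (fun q hq => hq.1)
    rwa [mul_one] at this
  have key := ODE_solution_unique_of_mem_Ioo (v := fun _ q => (q.2, q.1 - κ * dpot b q.1))
    (s := fun _ => Icc (min m₁ m₂) (max M₁ M₂) ×ˢ univ) (a := -(|t| + 1)) (b := |t| + 1) (t₀ := 0)
    (f := fun x => (z₁ x, w₁ x)) (g := fun x => (z₂ x, w₂ x))
    (fun _ _ => hv) ⟨by linarith, hT⟩
    (fun x hx => ⟨(hz₁ x).prodMk (hw₁ x),
      ⟨(min_le_left _ _).trans (hb₁ x (Ioo_subset_Icc_self hx)).1,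
        (hb₁ x (Ioo_subset_Icc_self hx)).2.trans (le_max_left _ _)⟩, trivial⟩)
    (fun x hx => ⟨(hz₂ x).prodMk (hw₂ x),
      ⟨(min_le_right _ _).trans (hb₂ x (Ioo_subset_Icc_self hx)).1,
        (hb₂ x (Ioo_subset_Icc_self hx)).2.trans (le_max_right _ _)⟩, trivial⟩)
    (by simp [hz, hw])
  have ht : t ∈ Ioo (-(|t| + 1)) (|t| + 1) :=
    ⟨by linarith [neg_abs_le t], by linarith [le_abs_self t]⟩
  exact congrArg Prod.fst (key ht)

/-- Zero energy and z'(0) = 0 leave only z(0) = 0, the equilibrium excluded by nonconstancy, or the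
turning point, where the data agree with the profile. -/
theorem IsSolitaryWave.eq_profile {b c k : ℝ} {φ : ℝ → ℝ} (hb : 1 < b)
    (hk : k ∈ Ioo 0 (c / (b + 1))) (h : IsSolitaryWave b c k φ) :
    φ = fun x => k + (c - k) * profile b (amplitude b c k) x := by
  have hkc := (lt_of_mem_background hb hk).2
  have hck : 0 < c - k := sub_pos.2 hkc
  have hY := amplitude_pos hb hk
  have hκ := inv_add_amplitude b c k
  set Y := amplitude b c k
  set κ := k / (c - k) with hκdef
  have hκ0 : 0 < κ := div_pos hk.1 hck
  have hlt := h.lt_speed hb hk.1 hkc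
  set z : ℝ → ℝ := fun x => (φ x - k) / (c - k) with hzdef
  set w : ℝ → ℝ := fun x => deriv φ x / (c - k) with hwdef
  have hφ : ∀ x, φ x = k + (c - k) * z x := fun x => by
    simp only [hzdef]
    field_simp
    ring
  have hz1 : ∀ x, z x < 1 := fun x => (div_lt_one hck).2 (by linarith [hlt x])
  have hz : ∀ x, HasDerivAt z (w x) x := fun x => ((h.hasDerivAt x).sub_const k).div_const (c - k)
  have hw : ∀ x, HasDerivAt w (z x - κ * dpot b (z x)) x := by
    intro x
    convert! (h.hasDerivAt_deriv x).div_const (c - k) using 1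
    have hm := h.momentum_eq_of_Ioi hkc (s := x - 1) (fun y _ => hlt y) (x := x) (by linarith)
    have hpos : 0 < 1 - z x := sub_pos.2 (hz1 x)
    have hcφ : c - φ x = (c - k) * (1 - z x) := by
      rw [hφ x]
      ring
    rw [hcφ, Real.mul_rpow hck.le hpos.le] at hm
    have hne1 : (c - k) ^ b ≠ 0 := (Real.rpow_pos_of_pos hck b).ne'
    have hne2 : (1 - z x) ^ b ≠ 0 := (Real.rpow_pos_of_pos hpos b).ne'
    have hm2 : iteratedDeriv 2 φ x = φ x - k * (1 - z x) ^ (-b) := by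
      rw [Real.rpow_neg hpos.le]
      field_simp
      apply mul_left_cancel₀ hne1
      linear_combination -hm
    rw [hm2, hφ x, dpot, hκdef]
    field_simp
    ring
  have hztop : Tendsto z atTop (𝓝 0) := by
    simpa using (h.tendsto_atTop.sub_const k).div_const (c - k)
  have henergy : ∀ x, w x ^ 2 = z x ^ 2 - 2 * κ * pot b (z x) := by
    have hd : ∀ x, HasDerivAt (fun x => w x ^ 2 - (z x ^ 2 - 2 * κ * pot b (z x))) 0 x := by
      intro x
      convert! ((hw x).pow 2).sub (((hz x).pow 2).sub
        (((hasDerivAt_pot hb (hz1 x)).comp x (hz x)).const_mul (2 * κ))) using 1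
      simp
      ring
    have hconst : ∀ x, w x ^ 2 - (z x ^ 2 - 2 * κ * pot b (z x)) =
        w 0 ^ 2 - (z 0 ^ 2 - 2 * κ * pot b (z 0)) := fun x =>
      is_const_of_deriv_eq_zero (fun x => (hd x).differentiableAt) (fun x => (hd x).deriv) x 0
    set E := w 0 ^ 2 - (z 0 ^ 2 - 2 * κ * pot b (z 0))
    have hpot : Tendsto (fun x => pot b (z x)) atTop (𝓝 0) := by
      have := (hasDerivAt_pot hb one_pos).continuousAt.tendsto.comp hztop
      simpa [pot_zero, Function.comp_def] using this
    have hlim : Tendsto (fun x => (z x ^ 2 - 2 * κ * pot b (z x)) + E) atTop (𝓝 E) := by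
      simpa using ((hztop.pow 2).sub (hpot.const_mul (2 * κ))).add_const E
    -- The energy law makes z'² converge to E; as z itself converges, the limit can only be 0.
    have hE : E = 0 := by
      have := limit_comp_deriv_eq (F := fun x => x ^ 2) hz hztop (by fun_prop)
        (hlim.congr fun x => by linarith [hconst x])
      simpa using this
    intro x
    linarith [hconst x]
  have hw0 : w 0 = 0 := by simp [hwdef, h.centred]
  have hz0 : z 0 = 0 ∨ z 0 = potInv b Y := by
    have h0 := henergy 0
    rw [hw0] at h0
    have hκb : κ * b < 1 := by
      rw [← hκ, inv_mul_lt_one₀ (by linarith)]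
      linarith
    rcases lt_trichotomy (z 0) 0 with hneg | hzero | hpos
    -- A negative value would give z² = 2κh(z) ≤ κbz² < z².
    · have h1 := two_mul_pot_le_of_nonpos hb hneg.le
      have h2 : 0 < z 0 ^ 2 := sq_pos_of_neg hneg
      nlinarith
    · exact Or.inl hzero
    · right
      have hmem : z 0 ∈ Ioo (0 : ℝ) 1 := ⟨hpos, hz1 0⟩
      have h1 : z 0 ^ 2 * (1 - κ * potRatio b (z 0)) = 0 := by
        linear_combination (-1 : ℝ) * h0 - κ * sq_mul_potRatio hb (z 0)
      have h2 : 1 - κ * potRatio b (z 0) = 0 :=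
        (mul_eq_zero.1 h1).resolve_left (by positivity)
      have h3 : potRatio b (z 0) = b + Y := by
        rw [← hκ] at h2
        have : b + Y ≠ 0 := by positivity
        field_simp at h2
        linarith
      rw [← potInv_potRatio hb hmem, h3, add_sub_cancel_left]
  have hzp : z = profile b Y := by
    rcases hz0 with hz0 | hz0
    · exfalso
      have h1 : z = fun _ => 0 := eq_of_normalized_ode (κ := κ) (b := b) hz hw hz1
        (w₂ := fun _ => 0) (fun x => hasDerivAt_const x 0)
        (fun x => by simpa [dpot_zero] using hasDerivAt_const x (0 : ℝ)) (fun _ => one_pos) hz0 hw0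
      obtain ⟨x, hx⟩ := h.nonconstant
      apply hx
      rw [hφ x, h1]
      simp
    · refine eq_of_normalized_ode (κ := κ) (b := b) hz hw hz1 (hasDerivAt_profile hb hY) ?_
        (fun x => (profile_mem hb hY x).2) (hz0.trans (profile_zero hb hY).symm) ?_
      · rw [← hκ]
        exact hasDerivAt_deriv_profile hb hY
      · rw [hw0, parameter_zero hb hY]
        simp
  ext x
  rw [hφ x, hzp]

theorem existsUnique_isSolitaryWave {b c k : ℝ} (hb : 1 < b) (hk : k ∈ Ioo 0 (c / (b + 1))) :
    ∃! φ : ℝ → ℝ, IsSolitaryWave b c k φ :=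
  ⟨_, isSolitaryWave_profile hb hk, fun _ h => h.eq_profile hb hk⟩

theorem solitaryWave_eq {b c k : ℝ} (hb : 1 < b) (hk : k ∈ Ioo 0 (c / (b + 1))) :
    solitaryWave b c k = fun x => k + (c - k) * profile b (amplitude b c k) x :=
  (Classical.epsilon_spec (p := IsSolitaryWave b c k)
    ⟨_, isSolitaryWave_profile hb hk⟩).eq_profile hb hk

theorem densityQ_solitaryWave {b c k : ℝ} (hb : 1 < b) (hk : k ∈ Ioo 0 (c / (b + 1))) :
    densityQ b c k (solitaryWave b c k) =
      fun x => -dens b (profile b (amplitude b c k) x) := by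
  have hY := amplitude_pos hb hk
  have hck : c - k ≠ 0 := by linarith [(lt_of_mem_background hb hk).2]
  ext x
  have hz := (profile_mem hb hY x).2
  rw [densityQ, solitaryWave_eq hb hk, dens]
  beta_reduce
  generalize profile b (amplitude b c k) x = z at *
  have h1 : (c - k) / (c - (k + (c - k) * z)) = (1 - z)⁻¹ := by
    rw [show c - (k + (c - k) * z) = (c - k) * (1 - z) by ring]
    have : 1 - z ≠ 0 := by linarith
    field_simp
  rw [h1, Real.inv_rpow (by linarith), Real.rpow_neg (by linarith), Real.rpow_neg_one]
  ring

/-! ### The functional as a function of the amplitude -/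

noncomputable section

/-- The derivative of `weight` with respect to `potRatio`. -/
def weightSlope (b z : ℝ) : ℝ := deriv (weight b) z / deriv (potRatio b) z

/-- The functional `-Q` as a function of the amplitude parameter. -/
def negQ (b Y : ℝ) : ℝ := 2 * √(Y * (b + Y)) * ∫ σ in Ioo (-1) 1, weight b (orbit b Y σ)

end

theorem mapQ_eq {b c k : ℝ} (hb : 1 < b) (hk : k ∈ Ioo 0 (c / (b + 1))) :
    mapQ b c k = -negQ b (amplitude b c k) := by
  rw [mapQ, densityQ_solitaryWave hb hk, integral_neg, negQ,
    integral_dens_profile hb (amplitude_pos hb hk)]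

theorem continuousOn_weightSlope {b : ℝ} (hb : 1 < b) : ContinuousOn (weightSlope b) (Ico 0 1) :=
  (continuousOn_deriv_weight hb).div (continuousOn_deriv_potRatio b)
    fun _ hz => (deriv_potRatio_pos hb hz.1 hz.2).ne'

theorem continuousOn_mul_weightSlope {b : ℝ} (hb : 1 < b) :
    ContinuousOn (fun z => (potRatio b z - b) * weightSlope b z) (Ico 0 1) :=
  ((HasDerivAt.continuousOn fun _ hz => hasDerivAt_potRatio hz.2).sub continuousOn_const).mul
    (continuousOn_weightSlope hb)

theorem potRatio_orbit {b Y σ : ℝ} (hb : 1 < b) (hY : 0 < Y) (hσ : σ ∈ Ioo (-1 : ℝ) 1) :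
    potRatio b (orbit b Y σ) = b + Y * (1 - σ ^ 2) :=
  potRatio_potInv hb (mul_pos hY (one_sub_sq_pos hσ))

theorem hasDerivAt_weight_orbit {b Y σ : ℝ} (hb : 1 < b) (hY : 0 < Y) (hσ : σ ∈ Ioo (-1 : ℝ) 1) :
    HasDerivAt (fun Y => weight b (orbit b Y σ)) ((1 - σ ^ 2) * weightSlope b (orbit b Y σ)) Y := by
  have ho := orbit_mem hb hY hσ
  have h1 : HasDerivAt (fun Y : ℝ => Y * (1 - σ ^ 2)) (1 - σ ^ 2) Y := hasDerivAt_mul_const _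
  have h2 : HasDerivAt (fun Y => orbit b Y σ) _ Y :=
    (hasDerivAt_potInv hb (mul_pos hY (one_sub_sq_pos hσ))).comp Y h1
  convert! (analyticAt_weight hb ho.1.le ho.2).differentiableAt.hasDerivAt.comp Y h2 using 1
  rw [weightSlope, orbit]
  ring

/-- Differentiation under the integral produces the factor 1 - σ², which on the orbit equals (H -
b)/Y. The bound over amplitudes in (0, 2Y) holds because those orbits stay in a compact part of
[0,1). -/
theorem hasDerivAt_integral_weight {b Y : ℝ} (hb : 1 < b) (hY : 0 < Y) :
    HasDerivAt (fun Y => ∫ σ in Ioo (-1) 1, weight b (orbit b Y σ))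
      ((∫ σ in Ioo (-1) 1, (potRatio b (orbit b Y σ) - b) * weightSlope b (orbit b Y σ)) / Y) Y := by
  obtain ⟨C, hC, hbd⟩ := exists_bound_comp_potInv hb (continuousOn_weightSlope hb) (2 * Y)
  have key := hasDerivAt_integral_of_dominated_loc_of_deriv_le
    (μ := volume.restrict (Ioo (-1 : ℝ) 1)) (F := fun Y σ => weight b (orbit b Y σ))
    (F' := fun Y σ => (1 - σ ^ 2) * weightSlope b (orbit b Y σ)) (bound := fun _ => C) (x₀ := Y)
    (s := Ioo 0 (2 * Y)) (Ioo_mem_nhds hY (by linarith)) ?_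
    (integrableOn_comp_orbit hb hY (continuousOn_weight hb)) ?_ ?_ (integrable_const C) ?_
  · convert! key.2 using 1
    rw [← integral_div]
    refine setIntegral_congr_fun measurableSet_Ioo fun σ hσ => ?_
    simp only [potRatio_orbit hb hY hσ]
    field_simp
    ring
  · filter_upwards [Ioi_mem_nhds hY] with y hy
    exact (continuousOn_comp_orbit hb hy (continuousOn_weight hb)).aestronglyMeasurable
      measurableSet_Ioo
  · refine ContinuousOn.aestronglyMeasurable ?_ measurableSet_Ioo
    exact ContinuousOn.mul (by fun_prop) (continuousOn_comp_orbit hb hY (continuousOn_weightSlope hb))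
  · refine (ae_restrict_iff' measurableSet_Ioo).2 (Eventually.of_forall fun σ hσ y hy => ?_)
    have h1 := one_sub_sq_pos hσ
    have h2 := hbd (y * (1 - σ ^ 2)) ⟨mul_pos hy.1 h1, by nlinarith [sq_nonneg σ, hy.1, hy.2]⟩
    rw [norm_mul, Real.norm_of_nonneg h1.le, Real.norm_eq_abs]
    calc (1 - σ ^ 2) * |weightSlope b (orbit b y σ)| ≤ 1 * C := by
          gcongr
          · linarith [sq_nonneg σ]
          · exact h2
      _ = C := one_mul C
  · refine (ae_restrict_iff' measurableSet_Ioo).2 (Eventually.of_forall fun σ hσ y hy => ?_)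
    exact hasDerivAt_weight_orbit hb hy.1 hσ

theorem integral_weight_pos {b Y : ℝ} (hb : 1 < b) (hY : 0 < Y) :
    0 < ∫ σ in Ioo (-1) 1, weight b (orbit b Y σ) := by
  have hpos : ∀ σ ∈ Ioo (-1 : ℝ) 1, 0 < weight b (orbit b Y σ) := fun σ hσ =>
    weight_pos hb (orbit_mem hb hY hσ).1 (orbit_mem hb hY hσ).2
  rw [setIntegral_pos_iff_support_of_nonneg_ae]
  · have : Ioo (-1 : ℝ) 1 ⊆ Function.support (fun σ => weight b (orbit b Y σ)) ∩ Ioo (-1) 1 :=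
      fun σ hσ => ⟨(hpos σ hσ).ne', hσ⟩
    exact lt_of_lt_of_le (by simp) (measure_mono this)
  · exact (ae_restrict_iff' measurableSet_Ioo).2 (Eventually.of_forall fun σ hσ => (hpos σ hσ).le)
  · exact integrableOn_comp_orbit hb hY (continuousOn_weight hb)

/-- The derivative of `negQ` is positive if a certain combination of integrals is. -/
theorem exists_hasDerivAt_negQ {b Y : ℝ} (hb : 1 < b) (hY : 0 < Y)
    (h : 0 < (∫ σ in Ioo (-1) 1, weight b (orbit b Y σ)) / 2 +
      ∫ σ in Ioo (-1) 1, (potRatio b (orbit b Y σ) - b) * weightSlope b (orbit b Y σ)) :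
    ∃ d > 0, HasDerivAt (negQ b) d Y := by
  have hI := hasDerivAt_integral_weight hb hY
  have hpos := integral_weight_pos hb hY
  set J := ∫ σ in Ioo (-1) 1, (potRatio b (orbit b Y σ) - b) * weightSlope b (orbit b Y σ)
  have hY2 : 0 < Y * (b + Y) := by positivity
  have h1 : HasDerivAt (fun Y => Y * (b + Y)) (b + 2 * Y) Y := by
    convert! (hasDerivAt_id Y).mul ((hasDerivAt_id Y).const_add b) using 1
    simp
    ring
  refine ⟨_, ?_, ((h1.sqrt hY2.ne').const_mul 2).mul hI⟩
  set I := ∫ σ in Ioo (-1) 1, weight b (orbit b Y σ)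
  have hN : 0 < √(Y * (b + Y)) := by positivity
  have hN2 : √(Y * (b + Y)) ^ 2 = Y * (b + Y) := Real.sq_sqrt hY2.le
  -- Splitting b + 2Y as (b + Y) + Y isolates the combination I/2 + J, leaving the positive
  -- remainder YI.
  have : 2 * ((b + 2 * Y) / (2 * √(Y * (b + Y)))) * I + 2 * √(Y * (b + Y)) * (J / Y) =
      (2 * (b + Y) * (I / 2 + J) + Y * I) / √(Y * (b + Y)) := by
    field_simp
    rw [hN2]
    ring
  rw [this]
  positivity

/-- The height never exceeds `potInv b Y`, so for small Y the whole orbit lies where W' > 0 and J ≥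
0. -/
theorem eventually_exists_hasDerivAt_negQ_nhdsGT {b : ℝ} (hb : 1 < b) :
    ∀ᶠ Y in 𝓝[>] (0 : ℝ), ∃ d > 0, HasDerivAt (negQ b) d Y := by
  have h := (tendsto_potInv_nhdsGT hb).eventually (eventually_deriv_weight_pos hb)
  obtain ⟨ε, hε, hsub⟩ := mem_nhdsGT_iff_exists_Ioo_subset.1 h
  filter_upwards [Ioo_mem_nhdsGT hε] with Y hY
  refine exists_hasDerivAt_negQ hb hY.1 ?_
  have h1 := integral_weight_pos hb hY.1
  have h2 : 0 ≤ ∫ σ in Ioo (-1) 1,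
      (potRatio b (orbit b Y σ) - b) * weightSlope b (orbit b Y σ) := by
    refine setIntegral_nonneg measurableSet_Ioo fun σ hσ => ?_
    have h3 := mul_pos hY.1 (one_sub_sq_pos hσ)
    have h4 : 0 < deriv (weight b) (orbit b Y σ) :=
      hsub ⟨h3, lt_of_le_of_lt (by nlinarith [sq_nonneg σ, hY.1]) hY.2⟩
    have ho := orbit_mem hb hY.1 hσ
    rw [potRatio_orbit hb hY.1 hσ, add_sub_cancel_left]
    exact (mul_pos h3 (div_pos h4 (deriv_potRatio_pos hb ho.1.le ho.2))).le
  linarith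

/-- For each fixed σ the height tends to 1 as Y → ∞. A finite limit at 1 also bounds f along all
orbits at once, so dominated convergence applies; 2 is the length of (-1,1). -/
theorem tendsto_integral_orbit {b L : ℝ} (hb : 1 < b) {f : ℝ → ℝ} (hf : ContinuousOn f (Ico 0 1))
    (hL : Tendsto f (𝓝[<] 1) (𝓝 L)) :
    Tendsto (fun Y => ∫ σ in Ioo (-1) 1, f (orbit b Y σ)) atTop (𝓝 (2 * L)) := by
  have hlim := hL.comp (tendsto_potInv_atTop hb)
  obtain ⟨y₁, hy₁⟩ := eventually_atTop.1
    (hlim.norm.eventually (gt_mem_nhds (lt_add_one ‖L‖)))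
  obtain ⟨C, -, hC⟩ := exists_bound_comp_potInv hb hf y₁
  have hbd : ∀ y, 0 < y → ‖f (potInv b y)‖ ≤ max C (‖L‖ + 1) := by
    intro y hy
    rcases le_total y y₁ with h | h
    · exact le_max_of_le_left (hC y ⟨hy, h⟩)
    · exact le_max_of_le_right (hy₁ y h).le
  have hconst : ∫ _ in Ioo (-1 : ℝ) 1, L = 2 * L := by
    simp
    norm_num
  rw [← hconst]
  refine tendsto_integral_filter_of_dominated_convergence (fun _ => max C (‖L‖ + 1)) ?_ ?_
    (integrable_const _) ?_
  · filter_upwards [eventually_gt_atTop 0] with Y hY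
    exact (continuousOn_comp_orbit hb hY hf).aestronglyMeasurable measurableSet_Ioo
  · filter_upwards [eventually_gt_atTop 0] with Y hY
    refine (ae_restrict_iff' measurableSet_Ioo).2 (Eventually.of_forall fun σ hσ => ?_)
    exact hbd _ (mul_pos hY (one_sub_sq_pos hσ))
  · refine (ae_restrict_iff' measurableSet_Ioo).2 (Eventually.of_forall fun σ hσ => ?_)
    exact hlim.comp (tendsto_id.atTop_mul_const (one_sub_sq_pos hσ))

theorem tendsto_integral_weight {b : ℝ} (hb : 1 < b) :
    Tendsto (fun Y => ∫ σ in Ioo (-1) 1, weight b (orbit b Y σ)) atTop (𝓝 1) := by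
  simpa using tendsto_integral_orbit hb (continuousOn_weight hb) (tendsto_weight_nhdsLT hb)

theorem eventually_exists_hasDerivAt_negQ_atTop {b : ℝ} (hb : 1 < b) :
    ∀ᶠ Y in atTop, ∃ d > 0, HasDerivAt (negQ b) d Y := by
  have h1 := tendsto_integral_orbit hb (continuousOn_mul_weightSlope hb)
    (tendsto_mul_deriv_weight_nhdsLT hb)
  have h2 := ((tendsto_integral_weight hb).div_const 2).add h1
  filter_upwards [h2.eventually (lt_mem_nhds (show (0 : ℝ) < 1 / 2 + 2 * 0 by norm_num)),
    eventually_gt_atTop 0] with Y hY hY0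
  exact exists_hasDerivAt_negQ hb hY0 hY

/-- The prefactor is at least 2Y and the integral tends to 1. -/
theorem tendsto_negQ_atTop {b : ℝ} (hb : 1 < b) : Tendsto (negQ b) atTop atTop := by
  refine Tendsto.atTop_mul_pos one_pos ?_ (tendsto_integral_weight hb)
  refine Tendsto.const_mul_atTop two_pos ?_
  refine tendsto_atTop_mono' _ ?_ tendsto_id
  filter_upwards [eventually_gt_atTop 0] with Y hY
  exact Real.le_sqrt_of_sq_le (by simp only [id]; nlinarith)

/-! ### Dependence on the normalized parameter -/

theorem amplitude_kOf {b c γ : ℝ} (hb : 1 < b) (hc : 0 < c) (hγ : γ ∈ Ioo (0 : ℝ) 1) :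
    amplitude b c (kOf b c γ) = b * γ / (1 - γ) := by
  have h1 : 1 - γ ≠ 0 := by linarith [hγ.2]
  have h2 : b + 1 - γ ≠ 0 := by linarith [hγ.2]
  rw [amplitude, kOf]
  field_simp
  ring

theorem mapQ_kOf {b c γ : ℝ} (hb : 1 < b) (hc : 0 < c) (hγ : γ ∈ Ioo (0 : ℝ) 1) :
    mapQ b c (kOf b c γ) = -negQ b (b * γ / (1 - γ)) := by
  rw [mapQ_eq hb (gammaOf_kOf hb hc hγ).1, amplitude_kOf hb hc hγ]

theorem exists_hasDerivAt_mapQ_kOf {b c γ : ℝ} (hb : 1 < b) (hc : 0 < c) (hγ : γ ∈ Ioo (0 : ℝ) 1)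
    (h : ∃ d > 0, HasDerivAt (negQ b) d (b * γ / (1 - γ))) :
    ∃ d < 0, HasDerivAt (fun γ => mapQ b c (kOf b c γ)) d γ := by
  obtain ⟨d, hd, hD⟩ := h
  have h1 : 0 < 1 - γ := by linarith [hγ.2]
  have h2 : HasDerivAt (fun γ : ℝ => b * γ / (1 - γ)) (b / (1 - γ) ^ 2) γ := by
    convert! ((hasDerivAt_id γ).const_mul b).div ((hasDerivAt_id γ).const_sub 1) h1.ne' using 1
    simp
    ring
  refine ⟨-(d * (b / (1 - γ) ^ 2)), neg_neg_of_pos (by positivity), ?_⟩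
  refine (hD.comp γ h2).neg.congr_of_eventuallyEq ?_
  filter_upwards [Ioo_mem_nhds hγ.1 hγ.2] with x hx
  exact mapQ_kOf hb hc hx

theorem tendsto_mul_div_one_sub_nhdsGT {b : ℝ} (hb : 1 < b) :
    Tendsto (fun γ : ℝ => b * γ / (1 - γ)) (𝓝[>] 0) (𝓝[>] 0) := by
  refine tendsto_nhdsWithin_iff.2 ⟨?_, ?_⟩
  · have : ContinuousAt (fun γ : ℝ => b * γ / (1 - γ)) 0 :=
      ContinuousAt.div (by fun_prop) (by fun_prop) (by norm_num)
    simpa using this.tendsto.mono_left nhdsWithin_le_nhds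
  · filter_upwards [Ioo_mem_nhdsGT (show (0 : ℝ) < 1 by norm_num)] with γ hγ
    exact div_pos (mul_pos (by linarith) hγ.1) (by linarith [hγ.2])

theorem tendsto_mul_div_one_sub_nhdsLT {b : ℝ} (hb : 1 < b) :
    Tendsto (fun γ : ℝ => b * γ / (1 - γ)) (𝓝[<] 1) atTop := by
  have h1 : Tendsto (fun γ : ℝ => (1 - γ)⁻¹) (𝓝[<] 1) atTop :=
    tendsto_inv_nhdsGT_zero.comp tendsto_one_sub_nhdsLT
  have h2 : Tendsto (fun γ : ℝ => b * γ) (𝓝[<] 1) (𝓝 (b * 1)) :=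
    ((continuous_const.mul continuous_id).tendsto 1).mono_left nhdsWithin_le_nhds
  exact Tendsto.pos_mul_atTop (by linarith) h2 h1

theorem eventually_hasDerivAt_mapQ_nhdsGT {b c : ℝ} (hb : 1 < b) (hc : 0 < c) :
    ∀ᶠ γ in 𝓝[>] (0 : ℝ), ∃ d < 0, HasDerivAt (fun γ => mapQ b c (kOf b c γ)) d γ := by
  filter_upwards [(tendsto_mul_div_one_sub_nhdsGT hb).eventually
    (eventually_exists_hasDerivAt_negQ_nhdsGT hb),
    Ioo_mem_nhdsGT (show (0 : ℝ) < 1 by norm_num)] with γ h hγ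
  exact exists_hasDerivAt_mapQ_kOf hb hc hγ h

theorem eventually_hasDerivAt_mapQ_nhdsLT {b c : ℝ} (hb : 1 < b) (hc : 0 < c) :
    ∀ᶠ γ in 𝓝[<] (1 : ℝ), ∃ d < 0, HasDerivAt (fun γ => mapQ b c (kOf b c γ)) d γ := by
  filter_upwards [(tendsto_mul_div_one_sub_nhdsLT hb).eventually
    (eventually_exists_hasDerivAt_negQ_atTop hb),
    Ioo_mem_nhdsLT (show (0 : ℝ) < 1 by norm_num)] with γ h hγ
  exact exists_hasDerivAt_mapQ_kOf hb hc hγ h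

theorem tendsto_mapQ_kOf_nhdsLT {b c : ℝ} (hb : 1 < b) (hc : 0 < c) :
    Tendsto (fun γ => mapQ b c (kOf b c γ)) (𝓝[<] (1 : ℝ)) atBot := by
  refine (tendsto_neg_atTop_atBot.comp
    ((tendsto_negQ_atTop hb).comp (tendsto_mul_div_one_sub_nhdsLT hb))).congr' ?_
  filter_upwards [Ioo_mem_nhdsLT (show (0 : ℝ) < 1 by norm_num)] with γ hγ
  exact (mapQ_kOf hb hc hγ).symm

/-! ### Monotonicity in the background -/

theorem strictAntiOn_gammaOf {b c : ℝ} (hb : 1 < b) (hc : 0 < c) :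
    StrictAntiOn (gammaOf b c) (Ioo 0 (c / (b + 1))) := by
  intro x hx y hy hxy
  have h1 := (lt_of_mem_background hb hx).2
  have h2 := (lt_of_mem_background hb hy).2
  rw [gammaOf, gammaOf, div_lt_div_iff₀ (by linarith) (by linarith)]
  nlinarith [mul_pos (mul_pos (zero_lt_one.trans hb) hc) (sub_pos.2 hxy)]

/-- Q is decreasing in γ and γ is decreasing in k. -/
theorem strictMonoOn_mapQ {b c p q : ℝ} (hb : 1 < b) (hc : 0 < c) {s : Set ℝ}
    (hs : s ⊆ Ioo 0 (c / (b + 1))) (hmaps : MapsTo (gammaOf b c) s (Ioo p q))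
    (hd : ∀ γ ∈ Ioo p q, ∃ d < 0, HasDerivAt (fun γ => mapQ b c (kOf b c γ)) d γ) :
    StrictMonoOn (mapQ b c) s := by
  have hanti : StrictAntiOn (fun γ => mapQ b c (kOf b c γ)) (Ioo p q) := by
    refine strictAntiOn_of_deriv_neg (convex_Ioo p q) (fun γ hγ => ?_) fun γ hγ => ?_
    · obtain ⟨d, -, h⟩ := hd γ hγ
      exact h.continuousAt.continuousWithinAt
    · rw [interior_Ioo] at hγ
      obtain ⟨d, hneg, h⟩ := hd γ hγ
      rwa [h.deriv]
  intro x hx y hy hxy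
  have := hanti (hmaps hy) (hmaps hx) (strictAntiOn_gammaOf hb hc (hs hx) (hs hy) hxy)
  simpa only [(kOf_gammaOf hb hc (hs hx)).2, (kOf_gammaOf hb hc (hs hy)).2] using this

theorem exists_strictMonoOn_mapQ_left {b c : ℝ} (hb : 1 < b) (hc : 0 < c) :
    ∃ δ ∈ Ioo 0 (c / (b + 1)), StrictMonoOn (mapQ b c) (Ioo 0 δ) := by
  obtain ⟨p, hp, hsub⟩ := (mem_nhdsLT_iff_exists_Ioo_subset' (show (0 : ℝ) < 1 by norm_num)).1
    ((eventually_hasDerivAt_mapQ_nhdsLT hb hc).and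
      (Ioo_mem_nhdsLT (show (0 : ℝ) < 1 by norm_num)))
  have hp1 : p < 1 := hp
  -- The midpoint is used because p may be 0, whose background c/(b+1) is not admissible as δ.
  have hm : (p + 1) / 2 ∈ Ioo p 1 := ⟨by linarith, by linarith⟩
  have hm2 := (hsub hm).2
  obtain ⟨hδ, hγδ⟩ := gammaOf_kOf hb hc hm2
  have hs : Ioo 0 (kOf b c ((p + 1) / 2)) ⊆ Ioo 0 (c / (b + 1)) := Ioo_subset_Ioo_right hδ.2.le
  refine ⟨_, hδ, strictMonoOn_mapQ hb hc hs (p := p) (q := 1) (fun x hx => ⟨?_, ?_⟩)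
    fun γ hγ => (hsub hγ).1⟩
  · have := strictAntiOn_gammaOf hb hc (hs hx) hδ hx.2
    rw [hγδ] at this
    exact hm.1.trans this
  · exact (kOf_gammaOf hb hc (hs hx)).1.2

theorem exists_strictMonoOn_mapQ_right {b c : ℝ} (hb : 1 < b) (hc : 0 < c) :
    ∃ δ ∈ Ioo 0 (c / (b + 1)), StrictMonoOn (mapQ b c) (Ioo δ (c / (b + 1))) := by
  obtain ⟨q, hq, hsub⟩ := mem_nhdsGT_iff_exists_Ioo_subset.1
    ((eventually_hasDerivAt_mapQ_nhdsGT hb hc).and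
      (Ioo_mem_nhdsGT (show (0 : ℝ) < 1 by norm_num)))
  have hq0 : 0 < q := hq
  -- Halving avoids q = 1, whose background is 0.
  have hm : q / 2 ∈ Ioo 0 q := ⟨by linarith, by linarith⟩
  have hm2 := (hsub hm).2
  obtain ⟨hδ, hγδ⟩ := gammaOf_kOf hb hc hm2
  have hs : Ioo (kOf b c (q / 2)) (c / (b + 1)) ⊆ Ioo 0 (c / (b + 1)) :=
    Ioo_subset_Ioo_left hδ.1.le
  refine ⟨_, hδ, strictMonoOn_mapQ hb hc hs (p := 0) (q := q) (fun x hx => ⟨?_, ?_⟩)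
    fun γ hγ => (hsub hγ).1⟩
  · exact (kOf_gammaOf hb hc (hs hx)).1.1
  · have := strictAntiOn_gammaOf hb hc hδ (hs hx) hx.1
    rw [hγδ] at this
    exact this.trans hm.2

theorem lemma7 (b c : ℝ) (hb : 1 < b) (hc : 0 < c) :
    (∀ k ∈ Ioo 0 (c / (b + 1)),
      (∃! φ : ℝ → ℝ, IsSolitaryWave b c k φ) ∧
      (∀ x, 0 < solitaryWave b c k x ∧ solitaryWave b c k x < c) ∧
      Integrable (densityQ b c k (solitaryWave b c k))) ∧
    (∃ δ ∈ Ioo 0 (c / (b + 1)), StrictMonoOn (mapQ b c) (Ioo 0 δ)) ∧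
    (∃ δ ∈ Ioo 0 (c / (b + 1)), StrictMonoOn (mapQ b c) (Ioo δ (c / (b + 1)))) ∧
    (∀ᶠ γ in 𝓝[>] (0 : ℝ), ∃ d < 0, HasDerivAt (fun γ => mapQ b c (kOf b c γ)) d γ) ∧
    (∀ᶠ γ in 𝓝[<] (1 : ℝ), ∃ d < 0, HasDerivAt (fun γ => mapQ b c (kOf b c γ)) d γ) ∧
    Tendsto (fun γ => mapQ b c (kOf b c γ)) (𝓝[<] (1 : ℝ)) atBot := by
  refine ⟨fun k hk => ⟨existsUnique_isSolitaryWave hb hk, fun x => ?_, ?_⟩,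
    exists_strictMonoOn_mapQ_left hb hc, exists_strictMonoOn_mapQ_right hb hc,
    eventually_hasDerivAt_mapQ_nhdsGT hb hc, eventually_hasDerivAt_mapQ_nhdsLT hb hc,
    tendsto_mapQ_kOf_nhdsLT hb hc⟩
  · have hck : 0 < c - k := sub_pos.2 (lt_of_mem_background hb hk).2
    have hz := profile_mem hb (amplitude_pos hb hk) x
    rw [solitaryWave_eq hb hk]
    exact ⟨add_pos hk.1 (mul_pos hck hz.1), by nlinarith [hz.2]⟩
  · rw [densityQ_solitaryWave hb hk]
    exact (integrable_dens_profile hb (amplitude_pos hb hk)).neg
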